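/- Equip $\mathbb C^6$ with the standard symplectic form $\omega=\sum_{j=1}^3 dz_j\wedge dz_{j+3}$. A plane $H\subset\mathbb P^5$ is called \emph{involutive} if it is the projectivization $\mathbb P(\Lambda)$ of a Lagrangian subspace $\Lambda\subset\mathbb C^6$, that is, of a three-dimensional linear subspace with $\omega|_\Lambda=0$. For integers $n\ge 1$ and $d\ge 0$ let $N(n,d)=\binom{n+d-1}{d}$ be the dimension of the space of homogeneous polynomials of degree $d$ in $n$ variables, and let $M(6,d)=\lceil N(6,d)/N(3,d)\rceil$. Theorem. Let $3\le d\le 12$, and let $\Sigma\subset\mathbb P^5$ be a disjoint union of $r=M(6,d)$ involutive planes in general position. Then the restriction map $$H^0(\mathbb P^5,\mathcal O(d))\longrightarrow H^0(\Sigma,\mathcal O_\Sigma(d))$$ has maximal rank, i.e. it is injective or surjective. Here $H^0(\mathbb P^5,\mathcal O(d))$ is the space of complex homogeneous polynomials of degree $d$ in six variables, $\Sigma$ has its reduced structure, and "in general position" means: there is a dense Zariski open subset $U$ of the $r$-fold product of the Lagrangian Grassmannian of $\mathbb C^6$ such that, for every $(\Lambda_1,\dots,\Lambda_r)\in U$,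 the planes $\mathbb P(\Lambda_1),\dots,\mathbb P(\Lambda_r)$ are pairwise disjoint and the restriction map for their union $\Sigma$ has maximal rank. -/

import Mathlib

open scoped LinearAlgebra.Projectivization

noncomputable section

namespace InvolutivePlanes

/-- The vector space `ℂ^{2n}`: `z (Sum.inl j)` is the coordinate `z_j` and `z (Sum.inr j)` is
the coordinate `z_{n+j}`. -/
abbrev PhaseSpace (n : ℕ) : Type := Fin n ⊕ Fin n → ℂ

/-- The standard symplectic form `ω = ∑ dz_j ∧ dz_{n+j}` on `ℂ^{2n}`. -/
def symplecticForm {n : ℕ} (z w : PhaseSpace n) : ℂ :=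
  ∑ j : Fin n, (z (Sum.inl j) * w (Sum.inr j) - z (Sum.inr j) * w (Sum.inl j))

/-- A linear subspace of `ℂ^{2n}` is Lagrangian if it has dimension `n` and `ω` vanishes
on it. -/
def IsLagrangian {n : ℕ} (L : Submodule ℂ (PhaseSpace n)) : Prop :=
  Module.finrank ℂ L = n ∧ ∀ z ∈ L, ∀ w ∈ L, symplecticForm z w = 0

/-- `N(n, d)`, the dimension of the space of homogeneous polynomials of degree `d` in `n`
variables. -/
def formCount (n d : ℕ) : ℕ := (n + d - 1).choose d

/-- `M(2n, d) = ⌈N(2n, d) / N(n, d)⌉`, with the even number `2n` as the first argument `m`. -/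
def subspaceCount (m d : ℕ) : ℕ := ⌈(formCount m d : ℚ) / (formCount (m / 2) d : ℚ)⌉₊

/-- The preimage of a subset of `ℙ(V)` under the projection `V ∖ {0} → ℙ(V)`. -/
def cone {σ : Type} (X : Set (ℙ ℂ (σ → ℂ))) : Set (σ → ℂ) :=
  {v | ∃ h : v ≠ 0, Projectivization.mk ℂ v h ∈ X}

/-- The linear subspace of `ℙ(V)` defined by a linear subspace `L` of `V`. -/
def projectiveSubspace {σ : Type} (L : Submodule ℂ (σ → ℂ)) : Set (ℙ ℂ (σ → ℂ)) :=
  {x | x.submodule ≤ L}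

/-- `H⁰(X, 𝒪_X(d))` for a Zariski closed subset `X` of a complex projective space, with its
reduced structure: the functions on the cone over `X` (without the origin) which are, locally
in the Zariski topology, quotients `p / q` of homogeneous polynomials with
`deg p = deg q + d`. -/
def sections {σ : Type} (X : Set (ℙ ℂ (σ → ℂ))) (d : ℕ) : Submodule ℂ (cone X → ℂ) where
  carrier := {f | ∀ x : cone X, ∃ (e : ℕ) (p q : MvPolynomial σ ℂ),
    p.IsHomogeneous (e + d) ∧ q.IsHomogeneous e ∧ MvPolynomial.eval x.1 q ≠ 0 ∧
    ∀ y : cone X, MvPolynomial.eval y.1 q ≠ 0 →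
      f y = MvPolynomial.eval y.1 p / MvPolynomial.eval y.1 q}
  zero_mem' := by
    intro x
    refine ⟨0, 0, 1, MvPolynomial.isHomogeneous_zero _ _ _, MvPolynomial.isHomogeneous_one _ _,
      by simp, ?_⟩
    intro y _
    simp
  add_mem' := by
    intro f g hf hg x
    obtain ⟨e₁, p₁, q₁, hp₁, hq₁, hx₁, h₁⟩ := hf x
    obtain ⟨e₂, p₂, q₂, hp₂, hq₂, hx₂, h₂⟩ := hg x
    refine ⟨e₁ + e₂, p₁ * q₂ + q₁ * p₂, q₁ * q₂, ?_, hq₁.mul hq₂, ?_, ?_⟩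
    · refine MvPolynomial.IsHomogeneous.add ?_ ?_
      · have := hp₁.mul hq₂
        rwa [show e₁ + d + e₂ = e₁ + e₂ + d by ring] at this
      · have := hq₁.mul hp₂
        rwa [← add_assoc] at this
    · rw [map_mul]
      exact mul_ne_zero hx₁ hx₂
    · intro y hy
      rw [map_mul] at hy
      rw [Pi.add_apply, h₁ y (left_ne_zero_of_mul hy), h₂ y (right_ne_zero_of_mul hy),
        div_add_div _ _ (left_ne_zero_of_mul hy) (right_ne_zero_of_mul hy)]
      simp
  smul_mem' := by
    intro c f hf x
    obtain ⟨e, p, q, hp, hq, hx, h⟩ := hf x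
    refine ⟨e, MvPolynomial.C c * p, q, hp.C_mul c, hq, hx, ?_⟩
    intro y hy
    rw [Pi.smul_apply, h y hy, smul_eq_mul, map_mul, MvPolynomial.eval_C, mul_div_assoc]

/-- The restriction map `H⁰(ℙ(V), 𝒪(d)) → H⁰(X, 𝒪_X(d))`, where `H⁰(ℙ(V), 𝒪(d))` is the space
of homogeneous polynomials of degree `d`. -/
def restriction {σ : Type} (X : Set (ℙ ℂ (σ → ℂ))) (d : ℕ) :
    MvPolynomial.homogeneousSubmodule σ ℂ d →ₗ[ℂ] sections X d where
  toFun p := ⟨fun v => MvPolynomial.eval v.1 p.1, by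
    intro x
    refine ⟨0, p.1, 1, ?_, MvPolynomial.isHomogeneous_one _ _, by simp, ?_⟩
    · rw [zero_add]
      exact (MvPolynomial.mem_homogeneousSubmodule d p.1).1 p.2
    · intro y _
      simp⟩
  map_add' p q := by
    ext v
    simp
  map_smul' c p := by
    ext v
    simp [MvPolynomial.smul_eval]

/-- A linear map has maximal rank if it is injective or surjective. -/
def HasMaximalRank {V W : Type} [AddCommGroup V] [Module ℂ V] [AddCommGroup W] [Module ℂ W]
    (f : V →ₗ[ℂ] W) : Prop :=
  Function.Injective f ∨ Function.Surjective f

/-- The Lagrangian Grassmannian of `ℂ^{2n}`, which parametrizes the involutive subspaces of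
`ℙ^{2n-1}`. -/
def LagrangianGrassmannian (n : ℕ) : Type :=
  {L : Submodule ℂ (PhaseSpace n) // IsLagrangian L}

/-- The variety of ordered `r`-tuples of involutive subspaces of `ℙ^{2n-1}`, that is, the
`r`-fold product of the Lagrangian Grassmannian. -/
def InvolutiveTuple (n r : ℕ) : Type := Fin r → LagrangianGrassmannian n

/-- `F` consists of a basis `F j` of the `j`-th Lagrangian subspace, for every `j`. -/
def IsFrame {n r : ℕ} (T : InvolutiveTuple n r) (F : Fin r → Fin n → PhaseSpace n) : Prop :=
  ∀ j, LinearIndependent ℂ (F j) ∧ Submodule.span ℂ (Set.range (F j)) = (T j).1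

/-- The value of a polynomial in the entries of the vectors of a frame. -/
def evalFrame {n r : ℕ} (F : Fin r → Fin n → PhaseSpace n)
    (p : MvPolynomial (Fin r × Fin n × (Fin n ⊕ Fin n)) ℂ) : ℂ :=
  MvPolynomial.eval (fun i => F i.1 i.2.1 i.2.2) p

/-- A set of tuples is Zariski open if the set of the frames of its members is Zariski open in
the variety of all frames of tuples of Lagrangian subspaces (which is a subvariety of an affine
space): it is cut out there by the condition that not all polynomials of some set vanish. -/
def IsZariskiOpen {n r : ℕ} (U : Set (InvolutiveTuple n r)) : Prop :=
  ∃ S : Set (MvPolynomial (Fin r × Fin n × (Fin n ⊕ Fin n)) ℂ),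
    ∀ (T : InvolutiveTuple n r) (F : Fin r → Fin n → PhaseSpace n), IsFrame T F →
      (T ∈ U ↔ ∃ p ∈ S, evalFrame F p ≠ 0)

/-- The Zariski topology on the variety of `r`-tuples of involutive subspaces. -/
instance zariskiTopology (n r : ℕ) : TopologicalSpace (InvolutiveTuple n r) where
  IsOpen := IsZariskiOpen
  isOpen_univ := ⟨{1}, fun T F _ => by simp [evalFrame]⟩
  isOpen_inter := by
    rintro U V ⟨S, hS⟩ ⟨S', hS'⟩
    refine ⟨{p | ∃ a ∈ S, ∃ b ∈ S', p = a * b}, fun T F h => ?_⟩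
    rw [Set.mem_inter_iff, hS T F h, hS' T F h]
    constructor
    · rintro ⟨⟨a, ha, ha0⟩, b, hb, hb0⟩
      refine ⟨a * b, ⟨a, ha, b, hb, rfl⟩, ?_⟩
      rw [evalFrame, map_mul]
      exact mul_ne_zero ha0 hb0
    · rintro ⟨p, ⟨a, ha, b, hb, rfl⟩, h0⟩
      rw [evalFrame, map_mul] at h0
      exact ⟨⟨a, ha, left_ne_zero_of_mul h0⟩, b, hb, right_ne_zero_of_mul h0⟩
  isOpen_sUnion := by
    intro s hs
    refine ⟨{p | ∃ U, ∃ h : U ∈ s, p ∈ (hs U h).choose}, fun T F h => ?_⟩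
    constructor
    · rintro ⟨U, hU, hT⟩
      obtain ⟨p, hp, h0⟩ := ((hs U hU).choose_spec T F h).1 hT
      exact ⟨p, ⟨U, hU, hp⟩, h0⟩
    · rintro ⟨p, ⟨U, hU, hp⟩, h0⟩
      exact ⟨U, hU, ((hs U hU).choose_spec T F h).2 ⟨p, hp, h0⟩⟩

/-- The `j`-th involutive subspace `ℙ(Λ_j) ⊆ ℙ^{2n-1}` of a tuple. -/
def InvolutiveTuple.member {n r : ℕ} (T : InvolutiveTuple n r) (j : Fin r) :
    Set (ℙ ℂ (PhaseSpace n)) :=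
  projectiveSubspace (T j).1

/-- The union `Σ` of the members of a tuple. -/
def InvolutiveTuple.union {n r : ℕ} (T : InvolutiveTuple n r) : Set (ℙ ℂ (PhaseSpace n)) :=
  ⋃ j, T.member j

end InvolutivePlanes

end

/-! Since `r` is `N(6,d) / N(3,d)` rounded up, the rank to expect is injectivity, and this is what
is shown for every `d` in the range. Injectivity is the nonvanishing of some maximal minor of a
matrix of monomial values, hence a Zariski open condition on tuples, and so is disjointness of two
members. Products of Lagrangian Grassmannians are irreducible: every nonempty open set contains
tuples of graphs `y = A x` of symmetric matrices, and two such tuples are joined by a line. So a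
single tuple with injective restriction is enough for each `d` (`exists_isOpen_dense`).

Such a tuple comes from a toric degeneration (`IndependentOn.add`). The torus `x_i ↦ t ^ a_i x_i`,
`y_i ↦ t ^ b_i y_i` with `a_i + b_i` constant preserves `ω` up to a factor, so it moves Lagrangian
planes to Lagrangian planes, and it scales each monomial by `t` to its weight. If the monomials of
weight at most `τ` are independent on `k` planes and the others on `l` planes, then moving the `k`
planes by a small `t` makes all of them independent on `k + l` planes: after rescaling, the
evaluation matrix tends to a block triangular one. Iteration cuts the monomials of degree `d` into
blocks, each to be tested on at most nine fixed planes. For `d = 5, 7, 11, 12` one has `N(6,d) = r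
N(3,d)`, so every block must consist of exactly `N(3,d)` monomials per plane.

A block is tested by restricting its monomials to the curve `(1, T, T ^ (d + 1))` in each plane and
taking coefficients in `T`. This gives an integer matrix; independence modulo `127` yields a minor
that is a nonzero integer, hence independence over `ℂ` (`eq_zero_of_residues`). The elimination is
run by the kernel on vectors packed into natural numbers, and `length_le_finrank_of_gauss` proves
that its success implies independence. -/

/-! ### Invertible minors of families of vectors -/

section LinearAlgebra

/-- If only the zero vector is orthogonal to all vectors `φ ω`, then some of these vectors form
an invertible square matrix. -/
theorem exists_det_ne_zero {K Ω ι : Type*} [Field K] [Fintype ι] [DecidableEq ι] (φ : Ω → ι → K)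
    (h : ∀ c : ι → K, (∀ ω, ∑ m, φ ω m * c m = 0) → c = 0) :
    ∃ a : ι → Ω, (Matrix.of fun i m => φ (a i) m).det ≠ 0 := by
  have hs : Submodule.span K (Set.range φ) = ⊤ := by
    by_contra hne
    obtain ⟨f, hf, hle⟩ := Submodule.exists_le_ker_of_lt_top _ (lt_top_iff_ne_top.2 hne)
    apply hf
    have hc := h (fun m => f (Pi.single m 1)) fun ω => by
      have h1 : f (φ ω) = 0 := hle (Submodule.subset_span ⟨ω, rfl⟩)
      rw [LinearMap.pi_apply_eq_sum_univ] at h1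
      have e : ∀ x : ι, (fun j => if x = j then (1 : K) else 0) = Pi.single x 1 := fun x => by
        ext j; simp [Pi.single_apply, eq_comm]
      simpa [e] using h1
    ext m
    simpa using congrFun hc m
  obtain ⟨b, -, -, hb, hli⟩ := exists_linearIndepOn_extension (K := K) (v := φ)
    (linearIndepOn_empty K φ) (Set.empty_subset Set.univ)
  have hsp : ⊤ ≤ Submodule.span K (Set.range fun x : b => φ x) := by
    rw [← hs, Submodule.span_le]
    intro x hx
    have := hb (by simpa using hx)
    rwa [Set.image_eq_range] at this
  let B := Module.Basis.mk hli hsp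
  let e := (Pi.basisFun K ι).indexEquiv B
  refine ⟨fun i => e i, ?_⟩
  rw [← isUnit_iff_ne_zero, ← Matrix.isUnit_iff_isUnit_det,
    ← Matrix.linearIndependent_rows_iff_isUnit]
  exact hli.comp e e.injective

theorem eq_zero_of_det_ne_zero {K Ω ι : Type*} [Field K] [Fintype ι] [DecidableEq ι]
    (φ : Ω → ι → K) (a : ι → Ω) (ha : (Matrix.of fun i m => φ (a i) m).det ≠ 0) (c : ι → K)
    (hc : ∀ ω, ∑ m, φ ω m * c m = 0) : c = 0 := by
  by_contra h
  exact ha (Matrix.exists_mulVec_eq_zero_iff.1 ⟨c, h, funext fun i => hc (a i)⟩)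

theorem exists_eval_ne_zero {K : Type*} [Field K] [Infinite K] {q : Polynomial K} (hq : q ≠ 0) :
    ∃ s, q.eval s ≠ 0 := by
  by_contra! h
  exact hq (Polynomial.funext fun s => by simpa using h s)

end LinearAlgebra

/-! ### Frames of Lagrangian subspaces and irreducibility of the space of tuples -/

namespace InvolutivePlanes

open Matrix

variable {n r : ℕ}

/-- The columns of the block matrix with upper block `X` and lower block `Y`. -/
def frameOf (X Y : Matrix (Fin n) (Fin n) ℂ) (k : Fin n) : PhaseSpace n :=
  Sum.elim (fun i => X i k) (fun i => Y i k)

theorem sum_smul_frameOf (X Y : Matrix (Fin n) (Fin n) ℂ) (c : Fin n → ℂ) :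
    ∑ k, c k • frameOf X Y k = Sum.elim (X *ᵥ c) (Y *ᵥ c) := by
  ext i
  rcases i with i | i <;>
    simp [frameOf, Finset.sum_apply, Matrix.mulVec, dotProduct, mul_comm]

theorem symplecticForm_elim (a b c d : Fin n → ℂ) :
    symplecticForm (Sum.elim a b : PhaseSpace n) (Sum.elim c d) = a ⬝ᵥ d - b ⬝ᵥ c := by
  simp [symplecticForm, dotProduct, Finset.sum_sub_distrib]

theorem linearIndependent_frameOf_iff (X Y : Matrix (Fin n) (Fin n) ℂ) :
    LinearIndependent ℂ (frameOf X Y) ↔ ∀ c, X *ᵥ c = 0 → Y *ᵥ c = 0 → c = 0 := by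
  rw [Fintype.linearIndependent_iff]
  constructor
  · intro h c hX hY
    ext i
    exact h c (by rw [sum_smul_frameOf, hX, hY]; ext i; rcases i with i | i <;> rfl) i
  · intro h c hc i
    rw [sum_smul_frameOf] at hc
    exact congrFun (h c (funext fun i => congrFun hc (Sum.inl i))
      (funext fun i => congrFun hc (Sum.inr i))) i

theorem linearIndependent_frameOf_of_det {X Y : Matrix (Fin n) (Fin n) ℂ} (hX : X.det ≠ 0) :
    LinearIndependent ℂ (frameOf X Y) :=
  (linearIndependent_frameOf_iff X Y).2 fun _ h _ => Matrix.eq_zero_of_mulVec_eq_zero hX h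

theorem isLagrangian_span_frameOf {X Y : Matrix (Fin n) (Fin n) ℂ} (hXY : Xᵀ * Y = Yᵀ * X)
    (h : LinearIndependent ℂ (frameOf X Y)) :
    IsLagrangian (Submodule.span ℂ (Set.range (frameOf X Y))) := by
  refine ⟨by rw [finrank_span_eq_card h, Fintype.card_fin], ?_⟩
  intro z hz w hw
  obtain ⟨c, rfl⟩ := (Submodule.mem_span_range_iff_exists_fun ℂ).1 hz
  obtain ⟨e, rfl⟩ := (Submodule.mem_span_range_iff_exists_fun ℂ).1 hw
  rw [sum_smul_frameOf, sum_smul_frameOf, symplecticForm_elim, sub_eq_zero,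
    ← Matrix.vecMul_transpose X c, ← Matrix.vecMul_transpose Y c, ← Matrix.dotProduct_mulVec,
    ← Matrix.dotProduct_mulVec, Matrix.mulVec_mulVec, Matrix.mulVec_mulVec, hXY]

theorem exists_frameOf (L : LagrangianGrassmannian n) :
    ∃ X Y : Matrix (Fin n) (Fin n) ℂ, Xᵀ * Y = Yᵀ * X ∧ LinearIndependent ℂ (frameOf X Y) ∧
      Submodule.span ℂ (Set.range (frameOf X Y)) = L.1 := by
  let b := Module.finBasisOfFinrankEq ℂ L.1 L.2.1
  have hb : frameOf (Matrix.of fun i k => (b k).1 (Sum.inl i))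
      (Matrix.of fun i k => (b k).1 (Sum.inr i)) = fun k => (b k).1 := by
    ext k i
    rcases i with i | i <;> rfl
  refine ⟨Matrix.of fun i k => (b k).1 (Sum.inl i), Matrix.of fun i k => (b k).1 (Sum.inr i),
    ?_, ?_, ?_⟩
  · ext k l
    have := L.2.2 _ (b k).2 _ (b l).2
    rw [symplecticForm, Finset.sum_sub_distrib, sub_eq_zero] at this
    simpa [Matrix.mul_apply] using this
  · rw [hb]
    exact b.linearIndependent.map' L.1.subtype (Submodule.ker_subtype _)
  · rw [hb]
    have := congrArg (Submodule.map L.1.subtype) b.span_eq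
    rwa [Submodule.map_span, Submodule.map_top, Submodule.range_subtype, ← Set.range_comp] at this

theorem frameOf_mul (X Y P : Matrix (Fin n) (Fin n) ℂ) (k : Fin n) :
    frameOf (X * P) (Y * P) k = ∑ l, P l k • frameOf X Y l := by
  rw [sum_smul_frameOf]
  ext i
  rcases i with i | i <;> simp [frameOf, Matrix.mul_apply, Matrix.mulVec, dotProduct]

theorem span_frameOf_mul_le (X Y P : Matrix (Fin n) (Fin n) ℂ) :
    Submodule.span ℂ (Set.range (frameOf (X * P) (Y * P))) ≤
      Submodule.span ℂ (Set.range (frameOf X Y)) := by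
  rw [Submodule.span_le]
  rintro _ ⟨k, rfl⟩
  rw [frameOf_mul]
  exact Submodule.sum_mem _ fun l _ => Submodule.smul_mem _ _ (Submodule.subset_span ⟨l, rfl⟩)

theorem span_frameOf_mul {X Y P : Matrix (Fin n) (Fin n) ℂ} (hP : P.det ≠ 0) :
    Submodule.span ℂ (Set.range (frameOf (X * P) (Y * P))) =
      Submodule.span ℂ (Set.range (frameOf X Y)) := by
  refine le_antisymm (span_frameOf_mul_le X Y P) ?_
  have := span_frameOf_mul_le (X * P) (Y * P) P⁻¹
  rwa [Matrix.mul_nonsing_inv_cancel_right _ _ (isUnit_iff_ne_zero.2 hP),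
    Matrix.mul_nonsing_inv_cancel_right _ _ (isUnit_iff_ne_zero.2 hP)] at this

theorem linearIndependent_frameOf_mul {X Y P : Matrix (Fin n) (Fin n) ℂ} (hP : P.det ≠ 0)
    (h : LinearIndependent ℂ (frameOf X Y)) :
    LinearIndependent ℂ (frameOf (X * P) (Y * P)) := by
  rw [linearIndependent_frameOf_iff] at h ⊢
  intro c hX hY
  rw [← Matrix.mulVec_mulVec] at hX hY
  exact Matrix.eq_zero_of_mulVec_eq_zero hP (h _ hX hY)

theorem isSymm_mul_inv {X Y : Matrix (Fin n) (Fin n) ℂ} (hXY : Xᵀ * Y = Yᵀ * X)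
    (hX : X.det ≠ 0) : (Y * X⁻¹).IsSymm := by
  have hu := isUnit_iff_ne_zero.2 hX
  have hu' : IsUnit (Xᵀ).det := by rwa [Matrix.det_transpose]
  rw [Matrix.IsSymm, Matrix.transpose_mul, Matrix.transpose_nonsing_inv]
  calc Xᵀ⁻¹ * Yᵀ = Xᵀ⁻¹ * (Yᵀ * X) * X⁻¹ := by
        rw [Matrix.mul_assoc, Matrix.mul_nonsing_inv_cancel_right _ _ hu]
    _ = Y * X⁻¹ := by rw [← hXY, ← Matrix.mul_assoc, Matrix.nonsing_inv_mul _ hu', Matrix.one_mul]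

/-- Every Lagrangian subspace is transversal to the graph of a suitable diagonal matrix. -/
theorem exists_diagonal_det_ne_zero {X Y : Matrix (Fin n) (Fin n) ℂ} (hXY : Xᵀ * Y = Yᵀ * X)
    (h : LinearIndependent ℂ (frameOf X Y)) :
    ∃ b : Fin n → ℂ, (X + Matrix.diagonal b * Y).det ≠ 0 := by
  classical
  obtain ⟨R, -, -, hR, hli⟩ := exists_linearIndepOn_extension (K := ℂ) (v := fun i => X i)
    (linearIndepOn_empty ℂ _) (Set.empty_subset Set.univ)
  -- `R` indexes a basis of the row space of `X`. At parameter `0` the rows of `X` outside `R` are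
  -- replaced by those of `Y`. If `c` is in the kernel, then `X c = 0`, so `Xᵀ Y c = Yᵀ X c = 0` is
  -- a linear relation among the rows of `X` in `R` with coefficients `(Y c)_i`; hence `Y c = 0` and
  -- `c = 0`. For a generic `u ≠ 0` the determinant stays nonzero, and dividing the rows outside `R`
  -- by `u` gives the diagonal matrix with entries `0` on `R` and `u⁻¹` elsewhere.
  let N : Matrix (Fin n) (Fin n) (Polynomial ℂ) := Matrix.of fun i k =>
    if i ∈ R then Polynomial.C (X i k)
    else Polynomial.X * Polynomial.C (X i k) + Polynomial.C (Y i k)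
  have hN : ∀ u : ℂ, N.det.eval u =
      (Matrix.of fun i k => if i ∈ R then X i k else u * X i k + Y i k).det := by
    intro u
    rw [← Polynomial.coe_evalRingHom, RingHom.map_det]
    congr 1
    ext i k
    by_cases hi : i ∈ R
    · simp [N, hi]
    · simp [N, hi, mul_comm u]
  have h0 : N.det.eval 0 ≠ 0 := by
    rw [hN]
    intro h0
    obtain ⟨c, hc0, hc⟩ := Matrix.exists_mulVec_eq_zero_iff.2 h0
    apply hc0
    have h1 : ∀ i ∈ R, X i ⬝ᵥ c = 0 := fun i hi => by
      simpa [Matrix.mulVec, hi, dotProduct] using congrFun hc i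
    have h2 : ∀ i ∉ R, Y i ⬝ᵥ c = 0 := fun i hi => by
      simpa [Matrix.mulVec, hi, dotProduct] using congrFun hc i
    have h3 : X *ᵥ c = 0 := by
      ext i
      have hi : X i ∈ Submodule.span ℂ ((fun i => X i) '' R) := hR ⟨i, trivial, rfl⟩
      change X i ⬝ᵥ c = 0
      generalize X i = x at hi
      induction hi using Submodule.span_induction with
      | mem x hx =>
        obtain ⟨j, hj, rfl⟩ := hx
        exact h1 j hj
      | zero => simp
      | add x y _ _ hx hy => rw [add_dotProduct, hx, hy, add_zero]
      | smul a x _ hx => rw [smul_dotProduct, hx, smul_zero]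
    have h4 : (Y *ᵥ c) ᵥ* X = 0 := by
      rw [← Matrix.mulVec_transpose, Matrix.mulVec_mulVec, hXY, ← Matrix.mulVec_mulVec, h3,
        Matrix.mulVec_zero]
    have h5 : ∑ i : R, (Y *ᵥ c) i • X i = 0 := by
      rw [Matrix.vecMul_eq_sum] at h4
      rw [← h4]
      refine Fintype.sum_of_injective (fun i : R => (i : Fin n)) Subtype.val_injective _
        (fun i => (Y *ᵥ c) i • X i) (fun i hi => ?_) fun _ => rfl
      have : (Y *ᵥ c) i = 0 := h2 i fun hi' => hi ⟨⟨i, hi'⟩, rfl⟩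
      simp only [this, zero_smul]
    have h6 : Y *ᵥ c = 0 := by
      ext i
      by_cases hi : i ∈ R
      · exact Fintype.linearIndependent_iff.1 hli (fun i => (Y *ᵥ c) i) h5 ⟨i, hi⟩
      · exact h2 i hi
    exact (linearIndependent_frameOf_iff X Y).1 h c h3 h6
  obtain ⟨u, hu⟩ := exists_eval_ne_zero (q := Polynomial.X * N.det)
    (mul_ne_zero Polynomial.X_ne_zero fun h => h0 (by rw [h, Polynomial.eval_zero]))
  rw [Polynomial.eval_mul, Polynomial.eval_X, hN] at hu
  have hu0 : u ≠ 0 := left_ne_zero_of_mul hu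
  refine ⟨fun i => if i ∈ R then 0 else u⁻¹, fun hd => right_ne_zero_of_mul hu ?_⟩
  have : (Matrix.of fun i k => if i ∈ R then X i k else u * X i k + Y i k) =
      Matrix.diagonal (fun i => if i ∈ R then 1 else u) *
        (X + Matrix.diagonal (fun i => if i ∈ R then 0 else u⁻¹) * Y) := by
    ext i k
    rw [Matrix.diagonal_mul, Matrix.add_apply, Matrix.diagonal_mul]
    by_cases hi : i ∈ R
    · simp [hi]
    · simp only [Matrix.of_apply, hi, if_false]
      rw [mul_add, ← mul_assoc, mul_inv_cancel₀ hu0, one_mul]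
  rw [this, Matrix.det_mul, hd, mul_zero]

/-- The tuple of the graphs of symmetric matrices. -/
def graphTuple (A : Fin r → Matrix (Fin n) (Fin n) ℂ) (hA : ∀ j, (A j).IsSymm) :
    InvolutiveTuple n r := fun j =>
  ⟨Submodule.span ℂ (Set.range (frameOf 1 (A j))),
    isLagrangian_span_frameOf (by simp [(hA j).eq])
      (linearIndependent_frameOf_of_det (by simp))⟩

theorem isFrame_graphTuple {A : Fin r → Matrix (Fin n) (Fin n) ℂ} (hA : ∀ j, (A j).IsSymm) :
    IsFrame (graphTuple A hA) fun j => frameOf 1 (A j) := fun _ =>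
  ⟨linearIndependent_frameOf_of_det (by simp), rfl⟩

theorem mem_graphTuple_iff {A : Fin r → Matrix (Fin n) (Fin n) ℂ} (hA : ∀ j, (A j).IsSymm)
    (j : Fin r) (v : PhaseSpace n) :
    v ∈ (graphTuple A hA j).1 ↔ ∃ x, v = Sum.elim x (A j *ᵥ x) := by
  change v ∈ Submodule.span ℂ _ ↔ _
  rw [Submodule.mem_span_range_iff_exists_fun]
  simp only [sum_smul_frameOf, Matrix.one_mulVec, eq_comm]

/-- A polynomial family of frames which meets an open set meets it outside of the zeros of a
polynomial. -/
theorem exists_polynomial_of_mem {U : Set (InvolutiveTuple n r)} (hU : IsOpen U)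
    (X Y : Fin r → Matrix (Fin n) (Fin n) (Polynomial ℂ)) {s₀ : ℂ} {T₀ : InvolutiveTuple n r}
    (hT₀ : IsFrame T₀ fun j => frameOf ((X j).map (Polynomial.eval s₀))
      ((Y j).map (Polynomial.eval s₀))) (hU₀ : T₀ ∈ U) :
    ∃ q : Polynomial ℂ, q ≠ 0 ∧ ∀ (s : ℂ) (T : InvolutiveTuple n r),
      IsFrame T (fun j => frameOf ((X j).map (Polynomial.eval s))
        ((Y j).map (Polynomial.eval s))) → q.eval s ≠ 0 → T ∈ U := by
  obtain ⟨S, hS⟩ := hU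
  obtain ⟨p, hp, hp0⟩ := (hS _ _ hT₀).1 hU₀
  let q : Polynomial ℂ := MvPolynomial.aeval (fun i : Fin r × Fin n × (Fin n ⊕ Fin n) =>
    Sum.elim (fun a => X i.1 a i.2.1) (fun a => Y i.1 a i.2.1) i.2.2) p
  have hq : ∀ s : ℂ, q.eval s = evalFrame (fun j => frameOf ((X j).map (Polynomial.eval s))
      ((Y j).map (Polynomial.eval s))) p := by
    intro s
    simp only [q]
    rw [← Polynomial.coe_aeval_eq_eval, evalFrame, ← MvPolynomial.aeval_eq_eval,
      ← AlgHom.comp_apply, MvPolynomial.comp_aeval]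
    congr 2
    ext ⟨j, k, a⟩
    rcases a with a | a <;> simp [frameOf]
  refine ⟨q, fun h => hp0 ?_, fun s T hT hs => (hS _ _ hT).2 ⟨p, hp, ?_⟩⟩
  · rw [← hq, h, Polynomial.eval_zero]
  · rwa [← hq]

/-- If `Z = X + diag(b) Y` is invertible, the frame `(X, Y)` may be normalized to `(1 - diag(b) A,
A)` with `A = Y Z⁻¹` symmetric. The family `(1 - s diag(b) A, s A)` gives the original tuple at `s =
1` and has invertible upper block at `s = 0`. A generic `s` therefore keeps the tuple in `U` and
makes every member a graph. -/
theorem exists_graphTuple_mem {U : Set (InvolutiveTuple n r)} (hU : IsOpen U)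
    (hne : U.Nonempty) : ∃ A hA, graphTuple A hA ∈ U := by
  obtain ⟨T, hT⟩ := hne
  choose X Y hXY hli hspan using fun j => exists_frameOf (T j)
  choose b hb using fun j => exists_diagonal_det_ne_zero (hXY j) (hli j)
  let Z : Fin r → Matrix (Fin n) (Fin n) ℂ := fun j => X j + Matrix.diagonal (b j) * Y j
  have hZ : ∀ j, (Z j).det ≠ 0 := hb
  have hZ' : ∀ j, ((Z j)⁻¹).det ≠ 0 := fun j => by
    rw [Matrix.det_nonsing_inv, Ring.inverse_eq_inv']
    exact inv_ne_zero (hZ j)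
  let A : Fin r → Matrix (Fin n) (Fin n) ℂ := fun j => Y j * (Z j)⁻¹
  have hA : ∀ j, (A j).IsSymm := fun j => isSymm_mul_inv (by
    simp only [Z, Matrix.transpose_add, Matrix.transpose_mul, Matrix.diagonal_transpose,
      Matrix.add_mul, Matrix.mul_add, hXY, Matrix.mul_assoc]) (hZ j)
  have hXA : ∀ j, X j * (Z j)⁻¹ = 1 - Matrix.diagonal (b j) * A j := fun j => by
    simp only [A]
    rw [eq_sub_iff_add_eq, ← Matrix.mul_assoc, ← Matrix.add_mul]
    exact Matrix.mul_nonsing_inv _ (isUnit_iff_ne_zero.2 (hZ j))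
  let P : Fin r → Matrix (Fin n) (Fin n) (Polynomial ℂ) := fun j =>
    1 - (Polynomial.X : Polynomial ℂ) • (Matrix.diagonal (b j) * A j).map Polynomial.C
  let Q : Fin r → Matrix (Fin n) (Fin n) (Polynomial ℂ) := fun j =>
    (Polynomial.X : Polynomial ℂ) • (A j).map Polynomial.C
  have hP : ∀ j s, (P j).map (Polynomial.eval s) = 1 - s • (Matrix.diagonal (b j) * A j) := by
    intro j s
    ext i k
    by_cases hik : i = k <;> simp [P, hik]
  have hQ : ∀ j s, (Q j).map (Polynomial.eval s) = s • A j := by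
    intro j s
    ext i k
    simp [Q, mul_comm s]
  obtain ⟨q, hq0, hq⟩ := exists_polynomial_of_mem hU P Q (s₀ := 1) (T₀ := T) (fun j => by
    beta_reduce
    rw [hP, hQ, one_smul, one_smul, ← hXA]
    exact ⟨linearIndependent_frameOf_mul (hZ' j) (hli j),
      (span_frameOf_mul (hZ' j)).trans (hspan j)⟩) hT
  have hdet : ∀ j s, (P j).det.eval s = (1 - s • (Matrix.diagonal (b j) * A j)).det := by
    intro j s
    rw [← hP, ← Polynomial.coe_evalRingHom, RingHom.map_det]
    rfl
  have hdet0 : ∏ j, (P j).det ≠ 0 := Finset.prod_ne_zero_iff.2 fun j _ h => by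
    have := hdet j 0
    simp [h] at this
  obtain ⟨s, hs⟩ := exists_eval_ne_zero (mul_ne_zero hq0 hdet0)
  rw [Polynomial.eval_mul, Polynomial.eval_prod] at hs
  have hs' : ∀ j, (1 - s • (Matrix.diagonal (b j) * A j)).det ≠ 0 := fun j => by
    rw [← hdet]
    exact Finset.prod_ne_zero_iff.1 (right_ne_zero_of_mul hs) j (Finset.mem_univ j)
  have hsymm : ∀ j, (s • A j * (1 - s • (Matrix.diagonal (b j) * A j))⁻¹).IsSymm := fun j =>
    isSymm_mul_inv (by
      simp only [Matrix.transpose_sub, Matrix.transpose_smul, Matrix.transpose_mul,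
        Matrix.diagonal_transpose, Matrix.transpose_one, (hA j).eq, Matrix.sub_mul,
        Matrix.mul_sub, Matrix.one_mul, Matrix.mul_one, Matrix.smul_mul, Matrix.mul_smul,
        Matrix.mul_assoc, smul_sub]) (hs' j)
  refine ⟨_, hsymm, hq s _ (fun j => ?_) (left_ne_zero_of_mul hs)⟩
  have hu := isUnit_iff_ne_zero.2 (hs' j)
  have hf : frameOf ((P j).map (Polynomial.eval s)) ((Q j).map (Polynomial.eval s)) =
      frameOf (1 * (1 - s • (Matrix.diagonal (b j) * A j)))
        (s • A j * (1 - s • (Matrix.diagonal (b j) * A j))⁻¹ *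
          (1 - s • (Matrix.diagonal (b j) * A j))) := by
    rw [hP, hQ, Matrix.one_mul, Matrix.nonsing_inv_mul_cancel_right _ _ hu]
  beta_reduce
  rw [hf]
  exact ⟨linearIndependent_frameOf_mul (hs' j) (linearIndependent_frameOf_of_det (by simp)),
    span_frameOf_mul (hs' j)⟩

/-- The variety of tuples of Lagrangian subspaces is irreducible. -/
instance : PreirreducibleSpace (InvolutiveTuple n r) where
  isPreirreducible_univ := by
    rintro U V hU hV hUne hVne
    rw [Set.univ_inter] at hUne hVne
    obtain ⟨A, hA, hAU⟩ := exists_graphTuple_mem hU hUne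
    obtain ⟨A', hA', hAV⟩ := exists_graphTuple_mem hV hVne
    -- The line from `A` to `A'` consists of symmetric matrices. It meets `U` at `0` and `V` at `1`,
    -- so each set contains all but finitely many of its points.
    let P : Fin r → Matrix (Fin n) (Fin n) (Polynomial ℂ) := fun _ => 1
    let Q : Fin r → Matrix (Fin n) (Fin n) (Polynomial ℂ) := fun j =>
      (A j).map Polynomial.C + (Polynomial.X : Polynomial ℂ) • (A' j - A j).map Polynomial.C
    have hP : ∀ j s, (P j).map (Polynomial.eval s) = 1 := by
      intro j s
      ext i k
      by_cases hik : i = k <;> simp [P, Matrix.one_apply, hik]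
    have hQ : ∀ j s, (Q j).map (Polynomial.eval s) = A j + s • (A' j - A j) := by
      intro j s
      ext i k
      simp [Q]
    obtain ⟨q, hq0, hq⟩ := exists_polynomial_of_mem hU P Q (s₀ := 0) (T₀ := graphTuple A hA)
      (by simpa [hP, hQ] using isFrame_graphTuple hA) hAU
    obtain ⟨q', hq0', hq'⟩ := exists_polynomial_of_mem hV P Q (s₀ := 1)
      (T₀ := graphTuple A' hA') (by simpa [hP, hQ] using isFrame_graphTuple hA') hAV
    obtain ⟨s, hs⟩ := exists_eval_ne_zero (mul_ne_zero hq0 hq0')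
    rw [Polynomial.eval_mul] at hs
    have hsymm : ∀ j, (A j + s • (A' j - A j)).IsSymm := fun j =>
      (hA j).add (((hA' j).sub (hA j)).smul s)
    have hf : IsFrame (graphTuple _ hsymm) fun j => frameOf ((P j).map (Polynomial.eval s))
        ((Q j).map (Polynomial.eval s)) := by
      simp only [hP, hQ]
      exact isFrame_graphTuple hsymm
    exact ⟨_, trivial, hq s _ hf (left_ne_zero_of_mul hs), hq' s _ hf (right_ne_zero_of_mul hs)⟩

end InvolutivePlanes

/-! ### Injectivity and disjointness as open conditions -/

namespace InvolutivePlanes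

open Matrix

variable {n r : ℕ}

/-- The value of the monomial with exponent `m`. -/
def monomialValue {σ : Type*} [Fintype σ] (m : σ →₀ ℕ) (v : σ → ℂ) : ℂ := ∏ i, v i ^ m i

/-- The exponents of the monomials of degree `d`. -/
def exponents (n d : ℕ) : Finset (Fin n ⊕ Fin n →₀ ℕ) := Finset.finsuppAntidiag Finset.univ d

theorem mem_exponents {d : ℕ} {m : Fin n ⊕ Fin n →₀ ℕ} :
    m ∈ exponents n d ↔ ∑ i, m i = d := by
  simp [exponents, Finset.mem_finsuppAntidiag]

theorem mem_exponents_iff_degree {d : ℕ} {m : Fin n ⊕ Fin n →₀ ℕ} :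
    m ∈ exponents n d ↔ m.degree = d := by
  rw [mem_exponents, Finsupp.degree_eq_sum]

theorem eval_eq_sum_exponents {d : ℕ} {p : MvPolynomial (Fin n ⊕ Fin n) ℂ}
    (hp : p.IsHomogeneous d) (v : PhaseSpace n) :
    MvPolynomial.eval v p = ∑ m ∈ exponents n d, p.coeff m * monomialValue m v := by
  rw [MvPolynomial.eval_eq']
  refine Finset.sum_subset (fun m hm => ?_) fun m _ hm => ?_
  · rw [mem_exponents_iff_degree]
    by_contra h
    exact (MvPolynomial.mem_support_iff.1 hm) (hp.coeff_eq_zero h)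
  · rw [MvPolynomial.notMem_support_iff.1 hm, zero_mul]

theorem mk_mem_member_iff {T : InvolutiveTuple n r} {j : Fin r} {v : PhaseSpace n} (hv : v ≠ 0) :
    Projectivization.mk ℂ v hv ∈ T.member j ↔ v ∈ (T j).1 := by
  rw [InvolutiveTuple.member, projectiveSubspace, Set.mem_ofPred_eq, Projectivization.submodule_mk,
    Submodule.span_singleton_le_iff_mem]

/-- Sections are functions on the cone, so the kernel is read off from values alone and the space of
sections need not be computed. The cone omits the origin, where a form of positive degree vanishes
anyway. -/
theorem injective_restriction_iff {T : InvolutiveTuple n r} {d : ℕ} (hd : d ≠ 0) :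
    Function.Injective (restriction T.union d) ↔
      ∀ p : MvPolynomial (Fin n ⊕ Fin n) ℂ, p.IsHomogeneous d →
        (∀ j, ∀ v ∈ (T j).1, MvPolynomial.eval v p = 0) → p = 0 := by
  rw [injective_iff_map_eq_zero]
  constructor
  · intro h p hp hv
    refine congrArg Subtype.val
      (h ⟨p, (MvPolynomial.mem_homogeneousSubmodule d p).2 hp⟩ ?_)
    ext ⟨v, hv0, hvT⟩
    obtain ⟨j, hj⟩ := Set.mem_iUnion.1 hvT
    exact hv j v ((mk_mem_member_iff hv0).1 hj)
  · rintro h ⟨p, hp⟩ hp0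
    have hp' := (MvPolynomial.mem_homogeneousSubmodule d p).1 hp
    refine Subtype.ext (h p hp' fun j v hv => ?_)
    by_cases hv0 : v = 0
    · rw [hv0, MvPolynomial.eval_zero, MvPolynomial.constantCoeff_eq]
      exact hp'.coeff_eq_zero (by simpa using hd.symm)
    · have := congrFun (congrArg Subtype.val hp0)
        ⟨v, hv0, Set.mem_iUnion.2 ⟨j, (mk_mem_member_iff hv0).2 hv⟩⟩
      exact this

theorem injective_restriction_iff_sum {T : InvolutiveTuple n r} {d : ℕ} (hd : d ≠ 0) :
    Function.Injective (restriction T.union d) ↔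
      ∀ c : exponents n d → ℂ,
        (∀ j, ∀ v ∈ (T j).1, ∑ m, monomialValue m.1 v * c m = 0) → c = 0 := by
  rw [injective_restriction_iff hd]
  constructor
  · intro h c hc
    let p : MvPolynomial (Fin n ⊕ Fin n) ℂ := ∑ m, MvPolynomial.monomial m.1 (c m)
    have hp : p = 0 := h p
      (MvPolynomial.IsHomogeneous.sum _ _ _ fun m _ => MvPolynomial.isHomogeneous_monomial _
        (mem_exponents_iff_degree.1 m.2)) fun j v hv => by
      rw [← hc j v hv]
      simp only [p, map_sum, MvPolynomial.eval_monomial]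
      refine Finset.sum_congr rfl fun m _ => ?_
      rw [mul_comm, Finsupp.prod_fintype _ _ fun i => pow_zero _]
      rfl
    ext m
    have := congrArg (MvPolynomial.coeff m.1) hp
    simpa [p, MvPolynomial.coeff_sum, MvPolynomial.coeff_monomial, Subtype.ext_iff.symm] using this
  · intro h p hp hv
    have hc := h (fun m => p.coeff m.1) fun j v hvj => by
      rw [← hv j v hvj, eval_eq_sum_exponents hp, ← Finset.sum_coe_sort (exponents n d)]
      exact Finset.sum_congr rfl fun m _ => mul_comm _ _
    ext m
    rw [MvPolynomial.coeff_zero]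
    by_cases hm : m ∈ exponents n d
    · exact congrFun hc ⟨m, hm⟩
    · exact hp.coeff_eq_zero fun h => hm (mem_exponents_iff_degree.2 h)

theorem mem_iff_of_isFrame {T : InvolutiveTuple n r} {F : Fin r → Fin n → PhaseSpace n}
    (hF : IsFrame T F) (j : Fin r) (v : PhaseSpace n) :
    v ∈ (T j).1 ↔ ∃ u : Fin n → ℂ, ∑ k, u k • F j k = v := by
  rw [← (hF j).2, Submodule.mem_span_range_iff_exists_fun]

theorem evalFrame_det {ι : Type*} [Fintype ι] [DecidableEq ι] (F : Fin r → Fin n → PhaseSpace n)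
    (M : Matrix ι ι (MvPolynomial (Fin r × Fin n × (Fin n ⊕ Fin n)) ℂ)) :
    evalFrame F M.det = (Matrix.of fun i j => evalFrame F (M i j)).det :=
  RingHom.map_det _ M

/-- Points of the members are written as fixed coefficient vectors applied to a frame. Monomial
values at them are then polynomials in the frame entries, and the defining set consists of the
determinants for all choices of such points. -/
theorem isOpen_injective_restriction {d : ℕ} (hd : d ≠ 0) :
    IsOpen {T : InvolutiveTuple n r | Function.Injective (restriction T.union d)} := by
  classical
  let Φ : Fin r × (Fin n → ℂ) → exponents n d →
      MvPolynomial (Fin r × Fin n × (Fin n ⊕ Fin n)) ℂ := fun ω m =>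
    ∏ i, (∑ k, MvPolynomial.C (ω.2 k) * MvPolynomial.X (ω.1, k, i)) ^ m.1 i
  refine ⟨{p | ∃ a : exponents n d → Fin r × (Fin n → ℂ), p = (Matrix.of fun i m => Φ (a i) m).det},
    fun T F hF => ?_⟩
  have hΦ : ∀ ω m, evalFrame F (Φ ω m) = monomialValue m.1 (∑ k, ω.2 k • F ω.1 k) := by
    intro ω m
    simp [Φ, evalFrame, monomialValue]
  have hdet : ∀ a : exponents n d → Fin r × (Fin n → ℂ),
      evalFrame F (Matrix.of fun i m => Φ (a i) m).det = (Matrix.of fun i m =>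
        monomialValue m.1 (∑ k, (a i).2 k • F (a i).1 k)).det := by
    intro a
    rw [evalFrame_det]
    simp only [Matrix.of_apply, hΦ]
  rw [Set.mem_ofPred_eq, injective_restriction_iff_sum hd]
  constructor
  · intro h
    obtain ⟨a, ha⟩ := exists_det_ne_zero (fun (ω : Fin r × (Fin n → ℂ)) (m : exponents n d) =>
      monomialValue m.1 (∑ k, ω.2 k • F ω.1 k)) fun c hc => h c fun j v hv => by
        obtain ⟨u, rfl⟩ := (mem_iff_of_isFrame hF j v).1 hv
        exact hc (j, u)
    exact ⟨_, ⟨a, rfl⟩, by rwa [hdet]⟩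
  · rintro ⟨p, ⟨a, rfl⟩, ha⟩ c hc
    rw [hdet] at ha
    exact eq_zero_of_det_ne_zero (fun (ω : Fin r × (Fin n → ℂ)) (m : exponents n d) =>
      monomialValue m.1 (∑ k, ω.2 k • F ω.1 k)) a ha c fun ω =>
        hc ω.1 _ ((mem_iff_of_isFrame hF _ _).2 ⟨ω.2, rfl⟩)

/-- Two subspaces of dimension `n` in `ℂ^{2n}` are disjoint exactly when their frames together form
an invertible matrix, so one determinant suffices. -/
theorem isOpen_disjoint (i j : Fin r) :
    IsOpen {T : InvolutiveTuple n r | Disjoint (T i).1 (T j).1} := by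
  refine ⟨{(Matrix.of fun (a b : Fin n ⊕ Fin n) =>
    (Sum.elim (fun k => MvPolynomial.X (i, k, b)) (fun k => MvPolynomial.X (j, k, b)) a :
      MvPolynomial (Fin r × Fin n × (Fin n ⊕ Fin n)) ℂ)).det}, fun T F hF => ?_⟩
  have h : evalFrame F (Matrix.of fun (a b : Fin n ⊕ Fin n) =>
      (Sum.elim (fun k => MvPolynomial.X (i, k, b)) (fun k => MvPolynomial.X (j, k, b)) a :
        MvPolynomial (Fin r × Fin n × (Fin n ⊕ Fin n)) ℂ)).det =
      (Matrix.of (Sum.elim (F i) (F j))).det := by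
    rw [evalFrame_det]
    refine congrArg Matrix.det (Matrix.ext fun a b => ?_)
    rcases a with a | a <;> simp [evalFrame]
  simp only [Set.mem_singleton_iff, exists_eq_left, h, Set.mem_ofPred_eq]
  rw [← isUnit_iff_ne_zero, ← Matrix.isUnit_iff_isUnit_det,
    ← Matrix.linearIndependent_rows_iff_isUnit]
  change _ ↔ LinearIndependent ℂ (Sum.elim (F i) (F j))
  rw [linearIndependent_sum]
  simp [Sum.elim_comp_inl, Sum.elim_comp_inr, (hF i).1, (hF j).1, (hF i).2, (hF j).2]

theorem disjoint_member {T : InvolutiveTuple n r} {i j : Fin r}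
    (h : Disjoint (T i).1 (T j).1) : Disjoint (T.member i) (T.member j) := by
  rw [Set.disjoint_left]
  intro x hi hj
  have := disjoint_iff_inf_le.1 h |>.trans' (le_inf hi hj)
  have h1 := x.finrank_submodule
  rw [le_bot_iff.1 this, finrank_bot] at h1
  exact zero_ne_one h1

theorem nonempty_disjoint {i j : Fin r} (hij : i ≠ j) :
    {T : InvolutiveTuple n r | Disjoint (T i).1 (T j).1}.Nonempty := by
  let A : Fin r → Matrix (Fin n) (Fin n) ℂ := fun l => if l = j then 1 else 0
  have hA : ∀ l, (A l).IsSymm := fun l => by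
    by_cases h : l = j <;> simp [A, h, Matrix.IsSymm]
  refine ⟨graphTuple A hA, ?_⟩
  rw [Set.mem_ofPred_eq, Submodule.disjoint_def]
  intro v hi hj
  rw [mem_graphTuple_iff] at hi hj
  obtain ⟨x, rfl⟩ := hi
  obtain ⟨y, hy⟩ := hj
  have h1 := fun a => congrFun hy (Sum.inl a)
  have h2 := fun a => congrFun hy (Sum.inr a)
  simp only [Sum.elim_inl, Sum.elim_inr, A, hij, if_true, if_false, Matrix.zero_mulVec,
    Matrix.one_mulVec, Pi.zero_apply] at h1 h2
  ext a
  rcases a with a | a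
  · simp [h1, ← h2]
  · simp [A, hij]

/-- Tuples of pairwise disjoint members for which the restriction map is injective form a dense
open set as soon as the restriction map is injective for some tuple. -/
theorem exists_isOpen_dense {d : ℕ} (hd : d ≠ 0)
    (h : ∃ T : InvolutiveTuple n r, Function.Injective (restriction T.union d)) :
    ∃ U : Set (InvolutiveTuple n r), IsOpen U ∧ Dense U ∧ ∀ T ∈ U,
      (∀ i j, i ≠ j → Disjoint (T.member i) (T.member j)) ∧
      HasMaximalRank (restriction T.union d) := by
  have hfin : {p : Fin r × Fin r | p.1 ≠ p.2}.Finite := Set.toFinite _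
  have hD : IsOpen (⋂ p ∈ {p : Fin r × Fin r | p.1 ≠ p.2},
      {T : InvolutiveTuple n r | Disjoint (T p.1).1 (T p.2).1}) :=
    hfin.isOpen_biInter fun p _ => isOpen_disjoint p.1 p.2
  have hI := isOpen_injective_restriction (n := n) (r := r) hd
  -- By irreducibility the nonempty open set of injectivity is dense; the finitely many disjointness
  -- conditions are handled the same way, one at a time.
  refine ⟨_, hI.inter hD, (hI.dense h).inter_of_isOpen_left ?_ hI, fun T hT => ⟨?_, Or.inl hT.1⟩⟩
  · have : ∀ s : Set (Fin r × Fin r), s.Finite → (∀ p ∈ s, p.1 ≠ p.2) →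
        Dense (⋂ p ∈ s, {T : InvolutiveTuple n r | Disjoint (T p.1).1 (T p.2).1}) := by
      intro s hs
      induction s, hs using Set.Finite.induction_on with
      | empty => simp
      | insert _ _ ih =>
        intro hp
        rw [Set.biInter_insert]
        exact ((isOpen_disjoint _ _).dense (nonempty_disjoint (hp _ (Set.mem_insert _ _)))).inter_of_isOpen_left
          (ih fun p h => hp p (Set.mem_insert_of_mem _ h)) (isOpen_disjoint _ _)
    exact this _ hfin fun p hp => hp
  · intro i j hij
    exact disjoint_member (Set.mem_iInter₂.1 hT.2 (i, j) hij)

/-! ### Independence of monomials and toric degeneration -/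

/-- The monomials with exponents in `F` are linearly independent as functions on the union of
`k` suitable graphs of symmetric matrices. -/
def IndependentOn (k : ℕ) (F : Finset (Fin n ⊕ Fin n →₀ ℕ)) : Prop :=
  ∃ A : Fin k → Matrix (Fin n) (Fin n) ℂ, (∀ j, (A j).IsSymm) ∧ ∀ c : F → ℂ,
    (∀ j x, ∑ m, monomialValue m.1 (Sum.elim x (A j *ᵥ x)) * c m = 0) → c = 0

theorem exists_injective_restriction {d : ℕ} (hd : d ≠ 0)
    (h : IndependentOn r (exponents n d)) :
    ∃ T : InvolutiveTuple n r, Function.Injective (restriction T.union d) := by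
  obtain ⟨A, hA, h⟩ := h
  refine ⟨graphTuple A hA, (injective_restriction_iff_sum hd).2 fun c hc => h c fun j x => ?_⟩
  exact hc j _ ((mem_graphTuple_iff hA _ _).2 ⟨x, rfl⟩)

/-- The weight of a monomial for the torus action `x_i ↦ t ^ a_i x_i`, `y_i ↦ t ^ b_i y_i`. -/
def weight (a b : Fin n → ℕ) (m : Fin n ⊕ Fin n →₀ ℕ) : ℕ := ∑ i, m i * Sum.elim a b i

theorem monomialValue_torus (a b : Fin n → ℕ) (m : Fin n ⊕ Fin n →₀ ℕ) (t : ℂ) (x y : Fin n → ℂ) :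
    monomialValue m (Sum.elim (fun i => t ^ a i * x i) (fun i => t ^ b i * y i)) =
      t ^ weight a b m * monomialValue m (Sum.elim x y) := by
  simp only [monomialValue, weight, ← Finset.prod_pow_eq_pow_sum, ← Finset.prod_mul_distrib]
  refine Finset.prod_congr rfl fun i _ => ?_
  rcases i with i | i <;> simp [mul_pow, ← pow_mul, mul_comm]

/-- Degeneration: the planes used for the monomials of small weight are moved by a one-parameter
group of symplectic similitudes. -/
theorem IndependentOn.add {k l c : ℕ} {a b : Fin n → ℕ} (hab : ∀ i, a i + b i = c)
    {F : Finset (Fin n ⊕ Fin n →₀ ℕ)} {τ : ℕ}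
    (hB : IndependentOn k (F.filter fun m => weight a b m ≤ τ))
    (hS : IndependentOn l (F.filter fun m => ¬ weight a b m ≤ τ)) : IndependentOn (k + l) F := by
  classical
  set B := F.filter fun m => weight a b m ≤ τ with hBdef
  set S := F.filter fun m => ¬ weight a b m ≤ τ with hSdef
  obtain ⟨A, hA, hAi⟩ := hB
  obtain ⟨A', hA', hAi'⟩ := hS
  obtain ⟨ω, hω⟩ := exists_det_ne_zero (fun (ω : Fin k × (Fin n → ℂ)) (m : B) =>
    monomialValue m.1 (Sum.elim ω.2 (A ω.1 *ᵥ ω.2))) fun c hc => hAi c fun j x => hc (j, x)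
  obtain ⟨ω', hω'⟩ := exists_det_ne_zero (fun (ω : Fin l × (Fin n → ℂ)) (m : S) =>
    monomialValue m.1 (Sum.elim ω.2 (A' ω.1 *ᵥ ω.2))) fun c hc => hAi' c fun j x => hc (j, x)
  let z : B → PhaseSpace n := fun i => Sum.elim (ω i).2 (A (ω i).1 *ᵥ (ω i).2)
  let z' : S → PhaseSpace n := fun i => Sum.elim (ω' i).2 (A' (ω' i).1 *ᵥ (ω' i).2)
  -- This is the evaluation matrix at the moved points of `z` and the fixed points `z'`, with the
  -- rows of `z` divided by `t ^ τ` and the unknowns in `B` multiplied by `t ^ (weight - τ)`. All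
  -- truncated differences here are true ones. At `t = 0` the upper right block vanishes, since
  -- weights in `S` exceed `τ`; the lower left one need not, as weight `τ` is allowed in `B`.
  let N : ℂ → Matrix (B ⊕ S) (B ⊕ S) ℂ := fun t => Matrix.fromBlocks
    (Matrix.of fun i m => monomialValue m.1 (z i))
    (Matrix.of fun i m => t ^ (weight a b m.1 - τ) * monomialValue m.1 (z i))
    (Matrix.of fun i m => t ^ (τ - weight a b m.1) * monomialValue m.1 (z' i))
    (Matrix.of fun i m => monomialValue m.1 (z' i))
  have hN0 : (N 0).det ≠ 0 := by
    have : (Matrix.of fun (i : B) (m : S) =>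
        (0 : ℂ) ^ (weight a b m.1 - τ) * monomialValue m.1 (z i)) = 0 := by
      ext i m
      have := (Finset.mem_filter.1 m.2).2
      simp [show weight a b m.1 - τ ≠ 0 by omega]
    simp only [N, this, Matrix.det_fromBlocks_zero₁₂]
    exact mul_ne_zero hω hω'
  have hcont : Continuous fun t => (N t).det := by
    refine Continuous.matrix_det (continuous_matrix fun i j => ?_)
    rcases i with i | i <;> rcases j with j | j <;>
      simp only [N, Matrix.fromBlocks_apply₁₁, Matrix.fromBlocks_apply₁₂,
        Matrix.fromBlocks_apply₂₁, Matrix.fromBlocks_apply₂₂, Matrix.of_apply] <;> fun_prop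
  obtain ⟨t, hNt, ht⟩ := (((hcont.tendsto 0).eventually_ne hN0).filter_mono
    nhdsWithin_le_nhds |>.and (self_mem_nhdsWithin (s := ({0}ᶜ : Set ℂ)))).exists
  replace ht : t ≠ 0 := ht
  -- The moved graph. As `b i - a l = c - a i - a l`, the scaling factor is symmetric in `i` and
  -- `l`.
  let At : Fin k → Matrix (Fin n) (Fin n) ℂ := fun j =>
    Matrix.of fun i l => t ^ b i * A j i l * (t ^ a l)⁻¹
  have hAt : ∀ j x, At j *ᵥ (fun i => t ^ a i * x i) = fun i => t ^ b i * (A j *ᵥ x) i := by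
    intro j x
    ext i
    simp only [At, Matrix.mulVec, dotProduct, Matrix.of_apply, Finset.mul_sum]
    refine Finset.sum_congr rfl fun l _ => ?_
    field_simp
  refine ⟨Fin.append At A', fun j => ?_, fun e he => ?_⟩
  · refine Fin.addCases (fun j => ?_) (fun j => ?_) j
    · rw [Fin.append_left]
      ext i l
      simp only [At, Matrix.transpose_apply, Matrix.of_apply]
      rw [(hA j).apply, mul_inv_eq_iff_eq_mul₀ (pow_ne_zero _ ht), mul_right_comm,
        eq_mul_inv_iff_mul_eq₀ (pow_ne_zero _ ht), mul_right_comm, ← pow_add, mul_right_comm (t ^ b i),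
        ← pow_add, add_comm (b l), hab, add_comm (b i), hab]
    · rw [Fin.append_right]
      exact hA' j
  · have hsub : ∀ m ∈ B, m ∈ F := fun m hm => (Finset.mem_filter.1 hm).1
    have hsub' : ∀ m ∈ S, m ∈ F := fun m hm => (Finset.mem_filter.1 hm).1
    let E : (Fin n ⊕ Fin n →₀ ℕ) → ℂ := fun m => if h : m ∈ F then e ⟨m, h⟩ else 0
    have hE : ∀ m : F, E m.1 = e m := fun m => by simp [E]
    have hsum : ∀ f : (Fin n ⊕ Fin n →₀ ℕ) → ℂ, ∑ m : F, f m.1 * e m =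
        ∑ m : B, f m.1 * E m.1 + ∑ m : S, f m.1 * E m.1 := by
      intro f
      rw [Finset.sum_coe_sort B fun m => f m * E m, Finset.sum_coe_sort S fun m => f m * E m,
        hBdef, hSdef, Finset.sum_filter_add_sum_filter_not, ← Finset.sum_coe_sort F]
      simp only [hE]
    let g : B ⊕ S → ℂ := Sum.elim (fun m => t ^ weight a b m.1 * (t ^ τ)⁻¹ * E m.1) fun m => E m.1
    have hg : N t *ᵥ g = 0 := by
      ext i
      rcases i with i | i
      · have h1 := he (Fin.castAdd l (ω i).1) fun s => t ^ a s * (ω i).2 s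
        rw [Fin.append_left, hAt, hsum fun m => monomialValue m _] at h1
        simp only [monomialValue_torus] at h1
        simp only [N, g, Matrix.mulVec, dotProduct, Fintype.sum_sum_type, Sum.elim_inl,
          Sum.elim_inr, Matrix.fromBlocks_apply₁₁, Matrix.fromBlocks_apply₁₂, Matrix.of_apply,
          Pi.zero_apply]
        rw [← mul_zero (t ^ τ)⁻¹, ← h1, mul_add, Finset.mul_sum, Finset.mul_sum]
        congr 1
        · refine Finset.sum_congr rfl fun m _ => ?_
          simp only [z]
          ring
        · refine Finset.sum_congr rfl fun m _ => ?_
          have hm := (Finset.mem_filter.1 m.2).2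
          have : t ^ (weight a b m.1 - τ) = (t ^ τ)⁻¹ * t ^ weight a b m.1 := by
            rw [pow_sub₀ _ ht (by omega), mul_comm]
          rw [this]
          simp only [z]
          ring
      · have h1 := he (Fin.natAdd k (ω' i).1) (ω' i).2
        rw [Fin.append_right, hsum fun m => monomialValue m _] at h1
        simp only [N, g, Matrix.mulVec, dotProduct, Fintype.sum_sum_type, Sum.elim_inl,
          Sum.elim_inr, Matrix.fromBlocks_apply₂₁, Matrix.fromBlocks_apply₂₂, Matrix.of_apply,
          Pi.zero_apply]
        rw [← h1]
        congr 1
        refine Finset.sum_congr rfl fun m _ => ?_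
        have hm := (Finset.mem_filter.1 m.2).2
        rw [pow_sub₀ _ ht hm]
        simp only [z']
        field_simp
    have hg0 : g = 0 := by
      by_contra h
      exact hNt (Matrix.exists_mulVec_eq_zero_iff.1 ⟨g, h, hg⟩)
    ext m
    rw [← hE, Pi.zero_apply]
    by_cases hm : weight a b m.1 ≤ τ
    · have := congrFun hg0 (Sum.inl ⟨m.1, Finset.mem_filter.2 ⟨m.2, hm⟩⟩)
      simpa [g, ht] using this
    · exact congrFun hg0 (Sum.inr ⟨m.1, Finset.mem_filter.2 ⟨m.2, hm⟩⟩)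

end InvolutivePlanes

/-! ### Vectors modulo 127 packed into natural numbers -/

section PackedVectors

/-- The `i`-th digit in base `2 ^ 24`. -/
def slot (N i : ℕ) : ℕ := N / 2 ^ (24 * i) % 2 ^ 24

theorem slot_zero (N : ℕ) : slot N 0 = N % 2 ^ 24 := by simp [slot]

theorem slot_succ (N i : ℕ) : slot N (i + 1) = slot (N / 2 ^ 24) i := by
  rw [slot, slot, Nat.div_div_eq_div_mul, ← pow_add, mul_add, mul_one, add_comm]

theorem slot_lt (N i : ℕ) : slot N i < 2 ^ 24 := Nat.mod_lt _ (by norm_num)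

theorem slot_add {M N i : ℕ} (h : ∀ j ≤ i, slot M j + slot N j < 2 ^ 24) :
    slot (M + N) i = slot M i + slot N i := by
  induction i generalizing M N with
  | zero =>
    have := h 0 le_rfl
    simp only [slot_zero] at this ⊢
    omega
  | succ i ih =>
    have h0 := h 0 (Nat.zero_le _)
    simp only [slot_zero] at h0
    have : (M + N) / 2 ^ 24 = M / 2 ^ 24 + N / 2 ^ 24 := by omega
    rw [slot_succ, slot_succ, slot_succ, this]
    refine ih fun j hj => ?_
    have := h (j + 1) (by omega)
    rwa [slot_succ, slot_succ] at this

theorem mul_mod_div_of_lt {c N X : ℕ} (h : c * (N % X) < X) :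
    c * N % X = c * (N % X) ∧ c * N / X = c * (N / X) := by
  have hX : 0 < X := by omega
  have e : c * N = c * (N % X) + X * (c * (N / X)) := by
    conv_lhs => rw [← Nat.mod_add_div N X, mul_add, mul_left_comm]
  constructor
  · rw [e, Nat.add_mul_mod_self_left, Nat.mod_eq_of_lt h]
  · rw [e, Nat.add_mul_div_left _ _ hX, Nat.div_eq_of_lt h, zero_add]

theorem slot_mul_left {c N i : ℕ} (h : ∀ j ≤ i, c * slot N j < 2 ^ 24) :
    slot (c * N) i = c * slot N i := by
  induction i generalizing N with
  | zero =>
    have := h 0 le_rfl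
    rw [slot_zero] at this
    rw [slot_zero, slot_zero, (mul_mod_div_of_lt this).1]
  | succ i ih =>
    have h0 := h 0 (Nat.zero_le _)
    rw [slot_zero] at h0
    rw [slot_succ, slot_succ, (mul_mod_div_of_lt h0).2]
    refine ih fun j hj => ?_
    have := h (j + 1) (by omega)
    rwa [slot_succ] at this

theorem slot_shift_zero (P : ℕ) : slot (2 ^ 24 * P) 0 = 0 := by
  rw [slot_zero]; exact Nat.mul_mod_right _ _

theorem slot_shift_succ (P i : ℕ) : slot (2 ^ 24 * P) (i + 1) = slot P i := by
  rw [slot_succ, Nat.mul_div_cancel_left _ (by norm_num)]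

/-- The product of packed vectors is their convolution as long as no digit overflows. -/
theorem slot_mul {a b N : ℕ} : ∀ (i M : ℕ), (i + 1) * (a * b) < 2 ^ 24 → (∀ j ≤ i, slot N j ≤ b) →
    (∀ j ≤ i, slot M j ≤ a) →
      slot (M * N) i = ∑ p ∈ Finset.HasAntidiagonal.antidiagonal i, slot M p.1 * slot N p.2 ∧
      slot (M * N) i ≤ (i + 1) * (a * b) := by
  intro i
  induction i using Nat.strong_induction_on with
  | _ i ih =>
    intro M hab hN hM
    have hle : ∀ k ≤ i, slot M 0 * slot N k ≤ a * b := fun k hk =>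
      Nat.mul_le_mul (hM 0 (Nat.zero_le _)) (hN k hk)
    have hab' : ∀ k ≤ i, (k + 1) * (a * b) < 2 ^ 24 := fun k hk =>
      lt_of_le_of_lt (Nat.mul_le_mul_right _ (by omega)) hab
    have h0 : ∀ k ≤ i, slot (slot M 0 * N) k = slot M 0 * slot N k := fun k hk =>
      slot_mul_left fun j hj => lt_of_le_of_lt (hle j (hj.trans hk))
        (by simpa using hab' 0 (Nat.zero_le _))
    have hdec : M * N = slot M 0 * N + 2 ^ 24 * (M / 2 ^ 24 * N) := by
      conv_lhs => rw [← Nat.mod_add_div M (2 ^ 24), add_mul, mul_assoc, ← slot_zero]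
    have hM' : ∀ k < i, slot (2 ^ 24 * (M / 2 ^ 24 * N)) (k + 1) =
        ∑ p ∈ Finset.HasAntidiagonal.antidiagonal k, slot M (p.1 + 1) * slot N p.2 ∧
        slot (2 ^ 24 * (M / 2 ^ 24 * N)) (k + 1) ≤ (k + 1) * (a * b) := by
      intro k hk
      rw [slot_shift_succ]
      simp only [slot_succ]
      exact ih k hk (M / 2 ^ 24) (hab' k hk.le) (fun j hj => hN j (by omega)) fun j hj => by
        rw [← slot_succ]; exact hM _ (by omega)
    have hsum : slot (M * N) i = slot M 0 * slot N i + slot (2 ^ 24 * (M / 2 ^ 24 * N)) i := by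
      rw [hdec, slot_add, h0 i le_rfl]
      intro j hj
      rw [h0 j hj]
      have h1 := hle j hj
      have h2 := hab' j hj
      obtain _ | j := j
      · rw [slot_shift_zero]
        omega
      · have := (hM' j (by omega)).2
        rw [add_mul] at h2
        omega
    rw [hsum]
    obtain _ | i := i
    · rw [slot_shift_zero]
      simpa using hle 0 le_rfl
    · obtain ⟨h1, h2⟩ := hM' i (by omega)
      rw [Finset.Nat.antidiagonal_succ, Finset.sum_cons, Finset.sum_map]
      constructor
      · rw [h1]; rfl
      · have := hle (i + 1) le_rfl
        rw [add_mul (i + 1)]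
        omega

theorem slot_two_pow (k i : ℕ) : slot (2 ^ (24 * k)) i = if i = k then 1 else 0 := by
  induction k generalizing i with
  | zero =>
    obtain _ | i := i
    · rfl
    · rw [slot_succ]
      simp [slot]
  | succ k ih =>
    rw [mul_add, mul_one, add_comm, pow_add]
    obtain _ | i := i
    · rw [slot_shift_zero]; simp
    · rw [slot_shift_succ, ih]; simp

theorem slot_mul_two_pow (N k i : ℕ) :
    slot (N * 2 ^ (24 * k)) i = if k ≤ i then slot N (i - k) else 0 := by
  induction k generalizing i with
  | zero => simp
  | succ k ih =>
    rw [show N * 2 ^ (24 * (k + 1)) = 2 ^ 24 * (N * 2 ^ (24 * k)) by ring]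
    obtain _ | i := i
    · rw [slot_shift_zero, if_neg (by omega)]
    · simp only [slot_shift_succ, ih, Nat.add_le_add_iff_right, Nat.add_sub_add_right]

theorem slot_concat (A B L i : ℕ) :
    slot (A * 2 ^ (24 * L) + B % 2 ^ (24 * L)) i = if i < L then slot B i else slot A (i - L) := by
  have hX : B % 2 ^ (24 * L) < 2 ^ (24 * L) := Nat.mod_lt _ (by positivity)
  split_ifs with h
  · have e : 2 ^ (24 * L) = 2 ^ (24 * i) * (2 ^ 24 * 2 ^ (24 * (L - i - 1))) := by
      rw [← pow_add, ← pow_add]; congr 1; omega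
    rw [slot, slot]
    conv_rhs => rw [← Nat.mod_add_div B (2 ^ (24 * L))]
    generalize B % 2 ^ (24 * L) = R
    rw [e, add_comm, ← mul_assoc, mul_comm A, mul_assoc, Nat.add_mul_div_left _ _ (by positivity),
      mul_assoc, Nat.add_mul_div_left _ _ (by positivity)]
    rw [add_comm, mul_comm A, mul_assoc, Nat.mul_add_mod, mul_assoc, Nat.add_mul_mod_self_left]
  · have e : 2 ^ (24 * i) = 2 ^ (24 * L) * 2 ^ (24 * (i - L)) := by
      rw [← pow_add]; congr 1; omega
    rw [slot, slot, e, ← Nat.div_div_eq_div_mul, add_comm, Nat.add_mul_div_right _ _ (by positivity),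
      Nat.div_eq_of_lt hX, zero_add]

theorem slot_geomSum {c L i : ℕ} (hc : c < 2 ^ 24) (hi : i < L) :
    slot (c * ((2 ^ (24 * L) - 1) / (2 ^ 24 - 1))) i = c := by
  have key : ∀ L i, i < L → slot (c * ∑ j ∈ Finset.range L, (2 ^ 24) ^ j) i = c := by
    intro L
    induction L with
    | zero => intro i hi; omega
    | succ L ih =>
      intro i hi
      rw [Finset.sum_range_succ', mul_add, pow_zero, mul_one]
      simp only [pow_succ' (2 ^ 24)]
      rw [← Finset.mul_sum, mul_left_comm]
      obtain _ | i := i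
      · rw [slot_zero, Nat.mul_add_mod, Nat.mod_eq_of_lt hc]
      · rw [slot_succ, Nat.mul_add_div (by norm_num), Nat.div_eq_of_lt hc, add_zero]
        exact ih i (by omega)
  rw [pow_mul, ← Nat.geomSum_eq (by norm_num)]
  exact key L i hi

/-- A mask which selects seven bits in each of the first `L` slots, and one which selects the
seventeen bits above those after a shift. -/
structure IsMask (L K K' : ℕ) : Prop where
  low : ∀ i < L, slot K i = 127
  high : ∀ i < L, slot K' i = 131071

/-- The packed vector all of whose first `L` slots are `1`. -/
noncomputable def ones (L : ℕ) : ℕ :=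
  Nat.div (Nat.sub (Nat.pow (nat_lit 2) (Nat.mul (nat_lit 24) L)) (nat_lit 1)) (nat_lit 16777215)

theorem ones_eq (L : ℕ) : ones L = (2 ^ (24 * L) - 1) / (2 ^ 24 - 1) := rfl

theorem isMask (L : ℕ) : IsMask L (Nat.mul 127 (ones L)) (Nat.mul 131071 (ones L)) := by
  rw [ones_eq]
  exact ⟨fun _ hi => slot_geomSum (by norm_num) hi, fun _ hi => slot_geomSum (by norm_num) hi⟩

theorem slot_land (M N i : ℕ) : slot (M &&& N) i = slot M i &&& slot N i := by
  rw [slot, slot, slot, Nat.and_div_two_pow, Nat.and_mod_two_pow]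

/-- Evaluate a numeral before it is substituted. -/
noncomputable def force {α : Type} (n : ℕ) (k : ℕ → α) : α :=
  Nat.rec (k Nat.zero) (fun m _ => k (Nat.succ m)) n

@[simp]
theorem force_eq {α : Type} (n : ℕ) (k : ℕ → α) : force n k = k n := by
  cases n <;> rfl

/-- Because `128 ≡ 1` modulo `127`, adding the upper seventeen bits of a digit to its lower seven
preserves the residue. The second mask discards the bits that the shift brings in from the next
slot. -/
noncomputable def foldSlots (K K' N : ℕ) : ℕ :=
  Nat.add (Nat.land N K) (Nat.land (Nat.shiftRight N (nat_lit 7)) K')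

theorem slot_foldSlots {L K K' : ℕ} (hK : IsMask L K K') {N i : ℕ} (hi : i < L) :
    slot (foldSlots K K' N) i = slot N i % 128 + slot N i / 128 := by
  have h1 : ∀ j < L, slot (Nat.land N K) j = slot N j % 128 := by
    intro j hj
    change slot (N &&& K) j = _
    rw [slot_land, hK.low j hj]
    exact Nat.and_two_pow_sub_one_eq_mod (slot N j) 7
  have h2 : ∀ j < L, slot (Nat.land (Nat.shiftRight N 7) K') j = slot N j / 128 := by
    intro j hj
    change slot (N >>> 7 &&& K') j = _
    rw [slot_land, hK.high j hj, Nat.shiftRight_eq_div_pow]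
    refine (Nat.and_two_pow_sub_one_eq_mod _ 17).trans ?_
    rw [slot, slot, Nat.div_div_eq_div_mul, mul_comm, ← Nat.div_div_eq_div_mul]
    omega
  change slot (Nat.land N K + Nat.land (Nat.shiftRight N 7) K') i = _
  rw [slot_add, h1 i hi, h2 i hi]
  intro j hj
  rw [h1 j (by omega), h2 j (by omega)]
  have := slot_lt N j
  omega

/-- Three folds bring a digit below `2 ^ 24` down to at most `131198`, then `1151`, then `135`. The
result is small but not a canonical residue. -/
noncomputable def reduceSlots (K K' N : ℕ) : ℕ :=
  force N fun a => force (foldSlots K K' a) fun b => force (foldSlots K K' b) fun c =>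
    foldSlots K K' c

theorem slot_reduceSlots_le {L K K' : ℕ} (hK : IsMask L K K') {N i : ℕ} (hi : i < L) :
    slot (reduceSlots K K' N) i ≤ 135 := by
  simp only [reduceSlots, force_eq, slot_foldSlots hK hi]
  have := slot_lt N i
  omega

theorem cast_mod_add_div (a : ℕ) : ((a % 128 + a / 128 : ℕ) : ZMod 127) = a := by
  conv_rhs => rw [← Nat.mod_add_div a 128]
  have : ((128 : ℕ) : ZMod 127) = 1 := rfl
  rw [Nat.cast_add, Nat.cast_add, Nat.cast_mul, this, one_mul]

theorem cast_slot_reduceSlots {L K K' : ℕ} (hK : IsMask L K K') {N i : ℕ} (hi : i < L) :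
    (slot (reduceSlots K K' N) i : ZMod 127) = slot N i := by
  simp only [reduceSlots, force_eq, slot_foldSlots hK hi, cast_mod_add_div]

/-- The residue of the `i`-th slot. -/
noncomputable def residue (N i : ℕ) : ℕ :=
  Nat.mod (Nat.land (Nat.shiftRight N (Nat.mul (nat_lit 24) i)) (nat_lit 16777215)) (nat_lit 127)

theorem residue_eq (N i : ℕ) : residue N i = slot N i % 127 := by
  change ((N >>> (24 * i)) &&& 16777215) % 127 = _
  rw [Nat.shiftRight_eq_div_pow, slot]
  exact congrArg (· % 127) (Nat.and_two_pow_sub_one_eq_mod _ 24)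

end PackedVectors

/-! ### Verified Gaussian elimination -/

section Elimination

/-- The residues modulo `127` of `L` slots. The slot with index zero is left out. -/
def slotVector (L N : ℕ) : Fin L → ZMod 127 := fun i => (slot N (i + 1) : ZMod 127)

/-- The span of the vectors which are packed in the members of a list. -/
def slotSpan (L : ℕ) (rs : List ℕ) : Submodule (ZMod 127) (Fin L → ZMod 127) :=
  Submodule.span _ (slotVector L '' {N | N ∈ rs})

instance : Fact (Nat.Prime 127) := ⟨by norm_num⟩

/-- The pivot step: the functional `f` is the pivot coordinate, `v` the pivot row and `S'` the rows
already cleared, so `v` lies outside the span of `S'`. -/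
theorem finrank_span_add_one_le {K V : Type*} [Field K] [AddCommGroup V] [Module K V]
    [FiniteDimensional K V] {S S' : Set V} {v : V} (f : V →ₗ[K] K) (hv : f v ≠ 0)
    (hS' : ∀ x ∈ S', f x = 0) (hvS : v ∈ Submodule.span K S) (hS'S : S' ⊆ Submodule.span K S) :
    Module.finrank K (Submodule.span K S') + 1 ≤ Module.finrank K (Submodule.span K S) := by
  refine Submodule.finrank_lt_finrank_of_lt (lt_of_le_of_ne (Submodule.span_le.2 hS'S) ?_)
  rintro h
  rw [← h] at hvS
  exact hv ((Submodule.span_le.2 fun x hx => LinearMap.mem_ker.2 (hS' x hx) :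
    Submodule.span K S' ≤ LinearMap.ker f) hvS)

/-- Add the multiples of `v` to the members of a list for which the slot at the bit `s` vanishes,
if the slot of `v` is `-1`. -/
noncomputable def eliminate (s v : ℕ) (rs acc : List ℕ) (k : List ℕ → Bool) : Bool :=
  List.rec (motive := fun _ => List ℕ → Bool) (fun acc => k acc)
    (fun r _ ih acc => Nat.rec (ih (List.cons r acc))
      (fun c _ => ih (List.cons (Nat.add r (Nat.mul (Nat.succ c) v)) acc))
      (Nat.mod (Nat.land (Nat.shiftRight r s) (nat_lit 16777215)) (nat_lit 127))) rs acc

theorem eliminate_eq (i v : ℕ) (rs acc : List ℕ) (k : List ℕ → Bool) :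
    eliminate (Nat.mul 24 i) v rs acc k =
      k ((rs.map fun r => r + residue r i * v).reverse ++ acc) := by
  induction rs generalizing acc with
  | nil => rfl
  | cons r rs ih =>
    have : eliminate (Nat.mul 24 i) v (r :: rs) acc k =
        eliminate (Nat.mul 24 i) v rs ((r + residue r i * v) :: acc) k := by
      change Nat.rec (motive := fun _ => Bool) (eliminate (Nat.mul 24 i) v rs (List.cons r acc) k)
        (fun c _ => eliminate (Nat.mul 24 i) v rs
          (List.cons (Nat.add r (Nat.mul (Nat.succ c) v)) acc) k) (residue r i) = _
      cases h : residue r i with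
      | zero => simp
      | succ c => rfl
    rw [this, ih]
    simp

/-- The index of the highest nonzero slot, if it is less than `2048`. -/
noncomputable def topSlot (N : ℕ) : ℕ :=
  Nat.rec (motive := fun _ => ℕ → ℕ) (fun i => i)
    (fun k ih i => force (Nat.add i (Nat.pow (nat_lit 2) k)) fun j =>
      Nat.rec (ih i) (fun _ _ => ih j) (Nat.shiftRight N (Nat.mul (nat_lit 24) j)))
    (nat_lit 11) (nat_lit 0)

/-- Replace the value `127` of a slot by `0`. -/
noncomputable def normalizeSlots (K O N : ℕ) : ℕ :=
  -- For digits up to `135`, adding `1` sets bit seven exactly from `127` on. Adding this bit and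
  -- keeping seven bits subtracts `127` from those digits.
  Nat.land (Nat.add N (Nat.land (Nat.shiftRight (Nat.add N O) (nat_lit 7)) O)) K

/-- The negative of the inverse modulo `127`. -/
noncomputable def negInv (a : ℕ) : ℕ :=
  Nat.sub (nat_lit 127) (Nat.mod (Nat.pow a (nat_lit 125)) (nat_lit 127))

/-- Conjunction which evaluates its second argument only if the first one is true. -/
noncomputable def andThen (a b : Bool) : Bool := Bool.rec false b a

theorem andThen_eq_true {a b : Bool} : andThen a b = true ↔ a = true ∧ b = true := by
  cases a <;> simp [andThen]

/-- Gaussian elimination, which succeeds if the vectors packed in the list are linearly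
independent. -/
noncomputable def gauss (K K' O L fuel : ℕ) : List ℕ → Bool :=
  Nat.rec (motive := fun _ => List ℕ → Bool) (fun rs => List.rec true (fun _ _ _ => false) rs)
    (fun _ ih rs => List.rec true (fun r rs _ =>
      force (reduceSlots K K' r) fun r => force (topSlot (normalizeSlots K O r)) fun i =>
        force (Nat.mul (nat_lit 24) i) fun s => force (negInv (residue r i)) fun c =>
          force (reduceSlots K K' (Nat.mul c r)) fun v =>
            andThen (Nat.beq (residue v i) (nat_lit 126)) (andThen (Nat.ble (nat_lit 1) i)
              (andThen (Nat.ble i L) (eliminate s v rs List.nil ih)))) rs) fuel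

/-- Each round lowers the dimension of the span by at least one and the number of rows by exactly
one. Nothing is needed about `topSlot`, `normalizeSlots` or `negInv`: the program itself verifies
that the pivot index is in range and the pivot entry is `-1`. Rows are reduced only when they become
pivots; before that a round adds at most `126 * 135 = 17010` to a digit, whence the bound on `b` and
the fuel. -/
theorem length_le_finrank_of_gauss {K K' O L : ℕ} (hK : IsMask (L + 1) K K') {fuel b : ℕ}
    (hb : b + 17010 * fuel < 2 ^ 24) {rs : List ℕ} (hrs : ∀ N ∈ rs, ∀ i < L + 1, slot N i ≤ b)
    (h : gauss K K' O L fuel rs = true) : rs.length ≤ Module.finrank (ZMod 127) (slotSpan L rs) := by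
  induction fuel generalizing b rs with
  | zero =>
    cases rs with
    | nil => exact Nat.zero_le _
    | cons r rs => exact absurd h Bool.false_ne_true
  | succ fuel ih =>
    cases rs with
    | nil => exact Nat.zero_le _
    | cons r₀ rs =>
      change force (reduceSlots K K' r₀) (fun r => force (topSlot (normalizeSlots K O r)) fun i =>
        force (Nat.mul (nat_lit 24) i) fun s => force (negInv (residue r i)) fun c =>
          force (reduceSlots K K' (Nat.mul c r)) fun v =>
            andThen (Nat.beq (residue v i) (nat_lit 126)) (andThen (Nat.ble (nat_lit 1) i)
              (andThen (Nat.ble i L) (eliminate s v rs List.nil (gauss K K' O L fuel))))) = true at h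
      simp only [force_eq, andThen_eq_true] at h
      set r := reduceSlots K K' r₀ with hr
      set i := topSlot (normalizeSlots K O r)
      set c := negInv (residue r i) with hc
      set v := reduceSlots K K' (Nat.mul c r) with hv
      obtain ⟨h1, h0, h2, h3⟩ := h
      rw [eliminate_eq, List.append_nil] at h3
      replace h1 : residue v i = 126 := Nat.eq_of_beq_eq_true h1
      replace h0 : 1 ≤ i := Nat.le_of_ble_eq_true h0
      replace h2 : i ≤ L := Nat.le_of_ble_eq_true h2
      have hc127 : c ≤ 127 := Nat.sub_le _ _
      have hvb : ∀ j < L + 1, slot v j ≤ 135 := fun j hj => slot_reduceSlots_le hK hj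
      have hvc : slotVector L v = (c : ZMod 127) • slotVector L r₀ := by
        ext j
        simp only [slotVector, Pi.smul_apply, smul_eq_mul]
        have hj : (j : ℕ) + 1 < L + 1 := Nat.succ_lt_succ j.2
        rw [hv, cast_slot_reduceSlots hK hj]
        change ((slot (c * r) (j + 1) : ℕ) : ZMod 127) = _
        rw [slot_mul_left, Nat.cast_mul, hr, cast_slot_reduceSlots hK hj]
        intro l hl
        have : slot r l ≤ 135 := slot_reduceSlots_le hK (by omega)
        calc c * slot r l ≤ 127 * 135 := Nat.mul_le_mul hc127 this
          _ < _ := by norm_num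
      have hvi : (slot v i : ZMod 127) = -1 := by
        rw [← ZMod.natCast_mod, ← residue_eq, h1]
        rfl
      have hslot : ∀ x ∈ rs, ∀ j < L + 1, slot (x + residue x i * v) j =
          slot x j + residue x i * slot v j := by
        intro x hx j hj
        have hle : ∀ l < L + 1, residue x i * slot v l ≤ 17010 := fun l hl => by
          have h126 : residue x i ≤ 126 := by
            rw [residue_eq]; have := Nat.mod_lt (slot x i) (show 127 > 0 by norm_num); omega
          exact Nat.mul_le_mul h126 (hvb l hl)
        have hs : ∀ l < L + 1, slot (residue x i * v) l = residue x i * slot v l := fun l hl =>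
          slot_mul_left fun m hm => lt_of_le_of_lt (hle m (by omega)) (by norm_num)
        rw [slot_add, hs j hj]
        intro l hl
        rw [hs l (by omega)]
        have := hle l (by omega)
        have := hrs x (List.mem_cons_of_mem _ hx) l (by omega)
        omega
      have hvec : ∀ x ∈ rs, slotVector L (x + residue x i * v) =
          slotVector L x + (residue x i : ZMod 127) • slotVector L v := by
        intro x hx
        ext j
        simp [slotVector, hslot x hx (j + 1) (Nat.succ_lt_succ j.2)]
      have hsub : slotVector L '' {N | N ∈ r₀ :: rs} ⊆ slotSpan L (r₀ :: rs) :=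
        Submodule.subset_span
      have hr₀ : slotVector L r₀ ∈ slotSpan L (r₀ :: rs) :=
        hsub ⟨r₀, List.mem_cons_self, rfl⟩
      have hvspan : slotVector L v ∈ slotSpan L (r₀ :: rs) := by
        rw [hvc]
        exact Submodule.smul_mem _ _ hr₀
      have hlen := ih (b := b + 17010) (by omega) (fun N hN j hj => ?_) h3
      · rw [List.length_reverse, List.length_map] at hlen
        rw [List.length_cons]
        refine (Nat.succ_le_succ hlen).trans (finrank_span_add_one_le (LinearMap.proj ⟨i - 1, by omega⟩)
          (v := slotVector L v) ?_ ?_ hvspan ?_)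
        · change (slot v (i - 1 + 1) : ZMod 127) ≠ 0
          rw [Nat.sub_add_cancel h0, hvi]
          exact neg_ne_zero.2 one_ne_zero
        · rintro _ ⟨N, hN, rfl⟩
          obtain ⟨x, hx, rfl⟩ := List.mem_map.1 (List.mem_reverse.1 hN)
          rw [hvec x hx, map_add, map_smul]
          change (slot x (i - 1 + 1) : ZMod 127) +
            (residue x i : ZMod 127) * (slot v (i - 1 + 1) : ZMod 127) = 0
          rw [Nat.sub_add_cancel h0, hvi, residue_eq, ZMod.natCast_mod]
          ring
        · rintro _ ⟨N, hN, rfl⟩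
          obtain ⟨x, hx, rfl⟩ := List.mem_map.1 (List.mem_reverse.1 hN)
          rw [hvec x hx]
          exact Submodule.add_mem _ (hsub ⟨x, List.mem_cons_of_mem _ hx, rfl⟩)
            (Submodule.smul_mem _ _ hvspan)
      · obtain ⟨x, hx, rfl⟩ := List.mem_map.1 (List.mem_reverse.1 hN)
        rw [hslot x hx j hj]
        have h126 : residue x i ≤ 126 := by
          rw [residue_eq]; have := Nat.mod_lt (slot x i) (show 127 > 0 by norm_num); omega
        exact Nat.add_le_add (hrs x (List.mem_cons_of_mem _ hx) j hj)
          (Nat.mul_le_mul h126 (hvb j hj))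

end Elimination

/-! ### Packed restrictions of monomials to curves -/

/-- The exponents of a monomial in the coordinates `x₁, x₂, x₃, y₁, y₂, y₃`. -/
structure Exponent where
  x₁ : ℕ
  x₂ : ℕ
  x₃ : ℕ
  y₁ : ℕ
  y₂ : ℕ
  y₃ : ℕ

/-- The entries on and above the diagonal of a symmetric matrix of size three. -/
structure SymmetricEntries where
  a₁₁ : ℕ
  a₁₂ : ℕ
  a₁₃ : ℕ
  a₂₂ : ℕ
  a₂₃ : ℕ
  a₃₃ : ℕ

instance : Inhabited SymmetricEntries := ⟨⟨0, 0, 0, 0, 0, 0⟩⟩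

section Rows

open Polynomial

/-- The first `L` slots of `N` represent the coefficients of `q`. -/
def Represents (L N : ℕ) (q : (ZMod 127)[X]) : Prop :=
  ∀ i < L, slot N i ≤ 135 ∧ (slot N i : ZMod 127) = q.coeff i

/-- A coefficient of the product is a sum of at most `900` products of digits up to `135`, and `900
* 135 ^ 2 < 2 ^ 24`, so multiplying the packed numbers produces no carry. -/
theorem Represents.mul {L K K' : ℕ} (hK : IsMask L K K') (hL : L ≤ 900) {M N : ℕ}
    {p q : (ZMod 127)[X]} (hM : Represents L M p) (hN : Represents L N q) :
    Represents L (reduceSlots K K' (Nat.mul M N)) (p * q) := by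
  intro i hi
  refine ⟨slot_reduceSlots_le hK hi, ?_⟩
  rw [cast_slot_reduceSlots hK hi]
  change ((slot (M * N) i : ℕ) : ZMod 127) = _
  rw [(slot_mul (a := 135) (b := 135) i M (by omega) (fun j hj => (hN j (by omega)).1)
    fun j hj => (hM j (by omega)).1).1, coeff_mul, Nat.cast_sum]
  refine Finset.sum_congr rfl fun x hx => ?_
  have := Finset.HasAntidiagonal.mem_antidiagonal.1 hx
  rw [Nat.cast_mul, (hM x.1 (by omega)).2, (hN x.2 (by omega)).2]

theorem Represents.mul_X_pow {L N : ℕ} {q : (ZMod 127)[X]} (h : Represents L N q) (k : ℕ) :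
    Represents L (N * 2 ^ (24 * k)) (q * X ^ k) := by
  intro i hi
  rw [slot_mul_two_pow, coeff_mul_X_pow']
  split_ifs
  · exact h _ (by omega)
  · simp

theorem represents_X_pow (L k : ℕ) : Represents L (2 ^ (24 * k)) (X ^ k) := by
  intro i _
  rw [slot_two_pow, coeff_X_pow]
  split_ifs <;> simp

/-- The linear form with the given coefficients on the curve `(1, T, T ^ D)`. -/
noncomputable def formOnCurve (R : Type*) [CommRing R] (D p q r : ℕ) : R[X] :=
  (p : R[X]) + (q : R[X]) * X + (r : R[X]) * X ^ D

noncomputable def packedForm (K K' D p q r : ℕ) : ℕ :=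
  reduceSlots K K' (Nat.add (Nat.add (Nat.mod p (nat_lit 127))
    (Nat.mul (Nat.mod q (nat_lit 127)) (Nat.pow (nat_lit 2) (nat_lit 24))))
      (Nat.mul (Nat.mod r (nat_lit 127)) (Nat.pow (nat_lit 2) (Nat.mul (nat_lit 24) D))))

theorem represents_packedForm {L K K' : ℕ} (hK : IsMask L K K') (D p q r : ℕ) :
    Represents L (packedForm K K' D p q r) (formOnCurve (ZMod 127) D p q r) := by
  intro i hi
  refine ⟨slot_reduceSlots_le hK hi, ?_⟩
  rw [packedForm, cast_slot_reduceSlots hK hi]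
  change ((slot (p % 127 + q % 127 * 2 ^ 24 + r % 127 * 2 ^ (24 * D)) i : ℕ) : ZMod 127) = _
  have hp := Nat.mod_lt p (show 127 > 0 by norm_num)
  have hq := Nat.mod_lt q (show 127 > 0 by norm_num)
  have hr := Nat.mod_lt r (show 127 > 0 by norm_num)
  have hmul : ∀ c k j, c < 127 → slot (c * 2 ^ (24 * k)) j = c * (if j = k then 1 else 0) := by
    intro c k j hc
    rw [← slot_two_pow]
    refine slot_mul_left fun l _ => ?_
    rw [slot_two_pow]
    split_ifs <;> omega
  have h0 : ∀ j, slot (p % 127) j = p % 127 * (if j = 0 then 1 else 0) := fun j => by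
    simpa using hmul (p % 127) 0 j hp
  have h1 : ∀ j, slot (q % 127 * 2 ^ 24) j = q % 127 * (if j = 1 then 1 else 0) := fun j =>
    hmul (q % 127) 1 j hq
  have h01 : ∀ j, slot (p % 127 + q % 127 * 2 ^ 24) j =
      p % 127 * (if j = 0 then 1 else 0) + q % 127 * (if j = 1 then 1 else 0) := by
    intro j
    rw [slot_add, h0, h1]
    intro l _
    rw [h0, h1]
    split_ifs <;> omega
  rw [slot_add, h01, hmul _ _ _ hr]
  · simp [formOnCurve, coeff_X, eq_comm]
  · intro l _
    rw [h01, hmul _ _ _ hr]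
    split_ifs <;> omega

/-- The list of `acc * y ^ e` for `e ≤ n`. -/
noncomputable def powerList (K K' y n acc : ℕ) : List ℕ :=
  Nat.rec (motive := fun _ => ℕ → List ℕ) (fun acc => [acc])
    (fun _ ih acc => acc :: ih (reduceSlots K K' (Nat.mul acc y))) n acc

/-- Continuation passing together with `force` makes each power a numeral before it is used, so that
it is not evaluated again at every occurrence. -/
noncomputable def withPowers (K K' y n acc : ℕ) (k : List ℕ → Bool) : Bool :=
  Nat.rec (motive := fun _ => ℕ → (List ℕ → Bool) → Bool) (fun acc k => k (List.cons acc List.nil))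
    (fun _ ih acc k => force (reduceSlots K K' (Nat.mul acc y)) fun acc' =>
      ih acc' fun l => k (List.cons acc l)) n acc k

theorem withPowers_eq (K K' y n acc : ℕ) (k : List ℕ → Bool) :
    withPowers K K' y n acc k = k (powerList K K' y n acc) := by
  induction n generalizing acc k with
  | zero => rfl
  | succ n ih =>
    change force (reduceSlots K K' (Nat.mul acc y)) (fun acc' =>
      withPowers K K' y n acc' fun l => k (List.cons acc l)) = _
    rw [force_eq, ih]
    rfl

noncomputable def nth (l : List ℕ) (e : ℕ) : ℕ :=
  Nat.rec (motive := fun _ => List ℕ → ℕ) (fun l => List.rec (nat_lit 0) (fun a _ _ => a) l)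
    (fun _ ih l => List.rec (nat_lit 0) (fun _ t _ => ih t) l) e l

theorem represents_nth_powerList {L K K' : ℕ} (hK : IsMask L K K') (hL : L ≤ 900) {y : ℕ}
    {q : (ZMod 127)[X]} (hy : Represents L y q) {n e : ℕ} (he : e ≤ n) {acc : ℕ}
    {p : (ZMod 127)[X]} (hacc : Represents L acc p) :
    Represents L (nth (powerList K K' y n acc) e) (p * q ^ e) := by
  induction e generalizing n acc p with
  | zero =>
    have : nth (powerList K K' y n acc) 0 = acc := by cases n <;> rfl
    rwa [this, pow_zero, mul_one]
  | succ e ih =>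
    obtain _ | n := n
    · omega
    · rw [pow_succ', ← mul_assoc]
      exact ih (by omega) (hacc.mul hK hL hy)

/-- The powers of three linear forms. -/
inductive PowerTable where
  | mk (l₁ l₂ l₃ : List ℕ)

noncomputable def powerTable (K K' D d : ℕ) (A : SymmetricEntries) : PowerTable :=
  .mk (powerList K K' (packedForm K K' D A.a₁₁ A.a₁₂ A.a₁₃) d (nat_lit 1))
    (powerList K K' (packedForm K K' D A.a₁₂ A.a₂₂ A.a₂₃) d (nat_lit 1))
    (powerList K K' (packedForm K K' D A.a₁₃ A.a₂₃ A.a₃₃) d (nat_lit 1))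

noncomputable def withPowerTable (K K' D d : ℕ) (A : SymmetricEntries)
    (k : PowerTable → Bool) : Bool :=
  force (packedForm K K' D A.a₁₁ A.a₁₂ A.a₁₃) fun f₁ =>
  force (packedForm K K' D A.a₁₂ A.a₂₂ A.a₂₃) fun f₂ =>
  force (packedForm K K' D A.a₁₃ A.a₂₃ A.a₃₃) fun f₃ =>
  withPowers K K' f₁ d (nat_lit 1) fun l₁ => withPowers K K' f₂ d (nat_lit 1) fun l₂ =>
  withPowers K K' f₃ d (nat_lit 1) fun l₃ => k (PowerTable.mk l₁ l₂ l₃)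

theorem withPowerTable_eq (K K' D d : ℕ) (A : SymmetricEntries) (k : PowerTable → Bool) :
    withPowerTable K K' D d A k = k (powerTable K K' D d A) := by
  unfold withPowerTable powerTable
  simp only [force_eq, withPowers_eq]

/-- Map a function in continuation passing style over a list. -/
noncomputable def withMap {α β : Type} (f : α → (β → Bool) → Bool) (l : List α)
    (k : List β → Bool) : Bool :=
  List.rec (motive := fun _ => (List β → Bool) → Bool) (fun k => k List.nil)
    (fun a _ ih k => ih fun bs => f a fun b => k (List.cons b bs)) l k

theorem withMap_eq {α β : Type} {f : α → (β → Bool) → Bool} {g : α → β}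
    (hf : ∀ a k, f a k = k (g a)) (l : List α) (k : List β → Bool) :
    withMap f l k = k (l.map g) := by
  induction l generalizing k with
  | nil => rfl
  | cons a l ih =>
    change withMap f l (fun bs => f a fun b => k (List.cons b bs)) = _
    rw [ih, hf, List.map_cons]

/-- The restriction of a monomial to the curve `(1, T, T ^ D)` on the graph of a matrix. -/
noncomputable def monomialOnCurve (R : Type*) [CommRing R] (D : ℕ) (A : SymmetricEntries)
    (m : Exponent) : R[X] :=
  formOnCurve R D A.a₁₁ A.a₁₂ A.a₁₃ ^ m.y₁ * formOnCurve R D A.a₁₂ A.a₂₂ A.a₂₃ ^ m.y₂ *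
    formOnCurve R D A.a₁₃ A.a₂₃ A.a₃₃ ^ m.y₃ * X ^ (m.x₂ + D * m.x₃)

/-- Multiplication by a power of `T` is a shift by whole digits and needs no reduction. What it
pushes beyond the `L` slots is cut off in `packedRow`. -/
noncomputable def packedMonomial (K K' D : ℕ) (t : PowerTable) (m : Exponent) : ℕ :=
  PowerTable.rec (fun l₁ l₂ l₃ => Exponent.rec (fun _ x₂ x₃ y₁ y₂ y₃ =>
    Nat.mul (reduceSlots K K' (Nat.mul (reduceSlots K K' (Nat.mul (nth l₁ y₁) (nth l₂ y₂)))
      (nth l₃ y₃))) (Nat.pow (nat_lit 2) (Nat.mul (nat_lit 24) (Nat.add x₂ (Nat.mul D x₃))))) m) t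

theorem represents_packedMonomial {L K K' : ℕ} (hK : IsMask L K K') (hL : L ≤ 900) {D d : ℕ}
    (A : SymmetricEntries) {m : Exponent} (h₁ : m.y₁ ≤ d) (h₂ : m.y₂ ≤ d) (h₃ : m.y₃ ≤ d) :
    Represents L (packedMonomial K K' D (powerTable K K' D d A) m)
      (monomialOnCurve (ZMod 127) D A m) := by
  have h : ∀ {p q r e : ℕ}, e ≤ d → Represents L
      (nth (powerList K K' (packedForm K K' D p q r) d 1) e)
      (formOnCurve (ZMod 127) D p q r ^ e) := by
    intro p q r e he
    have := represents_nth_powerList hK hL (represents_packedForm hK D p q r) he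
      (represents_X_pow L 0)
    simpa using this
  exact ((h h₁).mul hK hL (h h₂)).mul hK hL (h h₃) |>.mul_X_pow _

/-- The concatenation of the restrictions of a monomial to several planes. -/
noncomputable def packedRow (K K' D X : ℕ) (ts : List PowerTable) (m : Exponent) : ℕ :=
  List.rec (nat_lit 0) (fun t _ ih => Nat.add (Nat.mul ih X)
    (Nat.mod (packedMonomial K K' D t m) X)) ts

theorem slot_packedRow {L K K' : ℕ} (hK : IsMask L K K') (hL : L ≤ 900) (hL0 : 0 < L) {D d : ℕ}
    {m : Exponent} (h₁ : m.y₁ ≤ d) (h₂ : m.y₂ ≤ d) (h₃ : m.y₃ ≤ d) (As : List SymmetricEntries)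
    {i : ℕ} (hi : i < L * As.length) :
    slot (packedRow K K' D (2 ^ (24 * L)) (As.map (powerTable K K' D d)) m) i ≤ 135 ∧
    (slot (packedRow K K' D (2 ^ (24 * L)) (As.map (powerTable K K' D d)) m) i : ZMod 127) =
      (monomialOnCurve (ZMod 127) D (As.getD (i / L) default) m).coeff (i % L) := by
  induction As generalizing i with
  | nil => simp at hi
  | cons A As ih =>
    change slot (packedRow K K' D (2 ^ (24 * L)) (As.map (powerTable K K' D d)) m * 2 ^ (24 * L) +
      packedMonomial K K' D (powerTable K K' D d A) m % 2 ^ (24 * L)) i ≤ 135 ∧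
      ((slot (packedRow K K' D (2 ^ (24 * L)) (As.map (powerTable K K' D d)) m * 2 ^ (24 * L) +
      packedMonomial K K' D (powerTable K K' D d A) m % 2 ^ (24 * L)) i : ℕ) : ZMod 127) = _
    rw [slot_concat]
    split_ifs with h
    · rw [Nat.div_eq_of_lt h, Nat.mod_eq_of_lt h]
      exact represents_packedMonomial hK hL A h₁ h₂ h₃ i h
    · have hi' : i - L < L * As.length := by
        rw [List.length_cons, mul_add, mul_one] at hi
        omega
      have := ih hi'
      have e : i / L = (i - L) / L + 1 := by
        rw [← Nat.add_div_right _ hL0, Nat.sub_add_cancel (by omega)]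
      rw [e, List.getD_cons_succ, Nat.mod_eq_sub_mod (by omega)]
      exact this

/-- A number which depends on the exponent, in the slot with index zero, followed by the
restrictions of the monomial. It does not take part in the elimination: it keeps the low bits of
different rows apart. -/
noncomputable def taggedRow (K K' D X : ℕ) (ts : List PowerTable) (m : Exponent) : ℕ :=
  Nat.add (Exponent.rec (fun _ x₂ x₃ y₁ y₂ y₃ => Nat.mod (Nat.add (Nat.add x₂ (Nat.mul (nat_lit 13)
    x₃)) (Nat.add (Nat.mul (nat_lit 42) y₁) (Nat.add (Nat.mul (nat_lit 38) y₂)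
      (Nat.mul (nat_lit 113) y₃)))) (nat_lit 127)) m)
    (Nat.mul (nat_lit 16777216) (packedRow K K' D X ts m))

theorem slot_taggedRow (K K' D X : ℕ) (ts : List PowerTable) (m : Exponent) :
    slot (taggedRow K K' D X ts m) 0 ≤ 135 ∧
    ∀ i, slot (taggedRow K K' D X ts m) (i + 1) = slot (packedRow K K' D X ts m) i := by
  have h : ∀ a P, slot (a % 127 + 16777216 * P) 0 ≤ 135 ∧
      ∀ i, slot (a % 127 + 16777216 * P) (i + 1) = slot P i := by
    intro a P
    rw [slot_zero]
    refine ⟨by omega, fun i => ?_⟩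
    rw [slot_succ]
    congr 1
    omega
  exact h _ _

end Rows

/-! ### From elimination modulo 127 to independence over the complex numbers -/

namespace InvolutivePlanes

open Matrix Polynomial

/-- The exponent as a function on the coordinates. -/
noncomputable def exponentVector (m : Exponent) : Fin 3 ⊕ Fin 3 →₀ ℕ :=
  Finsupp.equivFunOnFinite.symm (Sum.elim ![m.x₁, m.x₂, m.x₃] ![m.y₁, m.y₂, m.y₃])

def ofExponentVector (m : Fin 3 ⊕ Fin 3 →₀ ℕ) : Exponent :=
  ⟨m (Sum.inl 0), m (Sum.inl 1), m (Sum.inl 2), m (Sum.inr 0), m (Sum.inr 1), m (Sum.inr 2)⟩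

theorem exponentVector_ofExponentVector (m : Fin 3 ⊕ Fin 3 →₀ ℕ) :
    exponentVector (ofExponentVector m) = m := by
  ext i
  rcases i with i | i <;> fin_cases i <;> rfl

/-- The set of the exponents in a list. -/
noncomputable def exponentSet (E : List Exponent) : Finset (Fin 3 ⊕ Fin 3 →₀ ℕ) :=
  (E.map exponentVector).toFinset

theorem mem_exponentSet {E : List Exponent} {m : Fin 3 ⊕ Fin 3 →₀ ℕ} :
    m ∈ exponentSet E ↔ ofExponentVector m ∈ E := by
  rw [exponentSet, List.mem_toFinset, List.mem_map]
  constructor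
  · rintro ⟨e, he, rfl⟩
    exact he
  · intro h
    exact ⟨_, h, exponentVector_ofExponentVector m⟩

/-- The symmetric matrix with the given entries. -/
def entriesMatrix (A : SymmetricEntries) : Matrix (Fin 3) (Fin 3) ℂ :=
  !![(A.a₁₁ : ℂ), A.a₁₂, A.a₁₃; A.a₁₂, A.a₂₂, A.a₂₃; A.a₁₃, A.a₂₃, A.a₃₃]

theorem isSymm_entriesMatrix (A : SymmetricEntries) : (entriesMatrix A).IsSymm := by
  ext i j
  fin_cases i <;> fin_cases j <;> rfl

theorem map_monomialOnCurve {R S : Type*} [CommRing R] [CommRing S] (f : R →+* S) (D : ℕ)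
    (A : SymmetricEntries) (m : Exponent) :
    (monomialOnCurve R D A m).map f = monomialOnCurve S D A m := by
  simp [monomialOnCurve, formOnCurve]

theorem eval_monomialOnCurve (D : ℕ) (A : SymmetricEntries) (m : Fin 3 ⊕ Fin 3 →₀ ℕ) (t : ℂ) :
    (monomialOnCurve ℂ D A (ofExponentVector m)).eval t =
      monomialValue m (Sum.elim ![1, t, t ^ D] (entriesMatrix A *ᵥ ![1, t, t ^ D])) := by
  simp [monomialOnCurve, formOnCurve, monomialValue, ofExponentVector, entriesMatrix,
    Fin.prod_univ_three, pow_add, pow_mul]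
  ring

/-- Independence modulo `127` provides a maximal minor that is nonzero modulo `127`. It is the
reduction of an integer minor, which is then nonzero in `ℂ` as well. -/
theorem eq_zero_of_residues {Ω ι : Type*} [Fintype ι] (R : Ω → ι → ℤ)
    (h : LinearIndependent (ZMod 127) fun m ω => (R ω m : ZMod 127)) (c : ι → ℂ)
    (hc : ∀ ω, ∑ m, (R ω m : ℂ) * c m = 0) : c = 0 := by
  classical
  obtain ⟨a, ha⟩ := exists_det_ne_zero (fun ω m => (R ω m : ZMod 127)) fun e he => by
    rw [Fintype.linearIndependent_iff] at h
    refine funext (h e ?_)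
    ext ω
    simpa [mul_comm] using he ω
  have hdet : (Matrix.of fun i m => R (a i) m).det ≠ 0 := by
    intro h0
    apply ha
    have := congrArg (Int.castRingHom (ZMod 127)) h0
    rw [RingHom.map_det, map_zero] at this
    exact this
  refine eq_zero_of_det_ne_zero (fun ω m => (R ω m : ℂ)) a ?_ c hc
  have : ((Matrix.of fun i m => R (a i) m).det : ℂ) ≠ 0 := Int.cast_ne_zero.2 hdet
  have e := RingHom.map_det (Int.castRingHom ℂ) (Matrix.of fun i m => R (a i) m)
  rw [eq_intCast] at e
  rw [e] at this
  exact this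

/-- The restrictions of the monomials in a list to curves in the graphs of the given matrices are
linearly independent modulo `127`. -/
noncomputable def independentRows (K K' D X M M' O N d : ℕ) (As : List SymmetricEntries)
    (E : List Exponent) : Bool :=
  withMap (withPowerTable K K' D d) As fun ts =>
  withMap (fun m k => force (taggedRow K K' D X ts m) k) E fun rows =>
    gauss M M' O N (nat_lit 980) rows

/-- A relation between the monomials on the graphs restricts to the curves and then holds for each
coefficient in `T`. Position `i` of a row is the coefficient of degree `i % L` on the plane with
index `i / L`. The slots are shifted by one because of the tag. -/
theorem independentOn_of_independentRows {d L K K' X M M' O : ℕ} {As : List SymmetricEntries}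
    (hK : IsMask L K K') (hM : IsMask (L * As.length + 1) M M') (hL : L ≤ 900) (hL0 : 0 < L)
    (hX : X = 2 ^ (24 * L)) {E : List Exponent} (hE : ∀ m ∈ E, m.y₁ ≤ d ∧ m.y₂ ≤ d ∧ m.y₃ ≤ d)
    {D : ℕ} (h : independentRows K K' D X M M' O (L * As.length) d As E = true) :
    IndependentOn As.length (exponentSet E) := by
  subst hX
  let row := taggedRow K K' D (2 ^ (24 * L)) (As.map (powerTable K K' D d))
  have hrow : ∀ m ∈ E, ∀ i < L * As.length, slot (row m) (i + 1) ≤ 135 ∧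
      (slot (row m) (i + 1) : ZMod 127) =
        (monomialOnCurve (ZMod 127) D (As.getD (i / L) default) m).coeff (i % L) := by
    intro m hm i hi
    rw [(slot_taggedRow _ _ _ _ _ m).2 i]
    exact slot_packedRow hK hL hL0 (hE m hm).1 (hE m hm).2.1 (hE m hm).2.2 As hi
  have hg : gauss M M' O (L * As.length) 980 (E.map row) = true := by
    rw [independentRows, withMap_eq (withPowerTable_eq _ _ _ _),
      withMap_eq (f := fun m k => force (row m) k) fun _ k => force_eq _ k] at h
    exact h
  have hlen := length_le_finrank_of_gauss hM (b := 135) (fuel := 980)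
    (by norm_num) (rs := E.map row) (fun N hN i hi => by
      obtain ⟨m, hm, rfl⟩ := List.mem_map.1 hN
      obtain _ | i := i
      · exact (slot_taggedRow _ _ _ _ _ m).1
      · exact (hrow m hm i (by omega)).1) hg
  rw [List.length_map] at hlen
  let R : Fin (L * As.length) → exponentSet E → ℤ := fun i m =>
    (monomialOnCurve ℤ D (As.getD (i / L) default) (ofExponentVector m.1)).coeff (i % L)
  have hR : ∀ m : exponentSet E, slotVector (L * As.length) (row (ofExponentVector m.1)) =
      fun i => (R i m : ZMod 127) := by
    intro m
    ext i
    rw [slotVector, (hrow _ (mem_exponentSet.1 m.2) i i.2).2,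
      ← map_monomialOnCurve (Int.castRingHom (ZMod 127)), coeff_map]
    rfl
  have hrange : slotVector (L * As.length) '' {N | N ∈ E.map row} =
      Set.range fun (m : exponentSet E) i => (R i m : ZMod 127) := by
    ext v
    constructor
    · rintro ⟨N, hN, rfl⟩
      obtain ⟨m, hm, rfl⟩ := List.mem_map.1 hN
      exact ⟨⟨exponentVector m, mem_exponentSet.2 hm⟩, (hR _).symm⟩
    · rintro ⟨m, rfl⟩
      exact ⟨row (ofExponentVector m.1), List.mem_map.2 ⟨_, mem_exponentSet.1 m.2, rfl⟩, hR m⟩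
  have hli : LinearIndependent (ZMod 127) fun (m : exponentSet E) i => (R i m : ZMod 127) := by
    rw [linearIndependent_iff_card_le_finrank_span, Fintype.card_coe, ← hrange]
    -- The list need not be known to be free of repetitions: the rank is at least its length, which
    -- bounds the size of the set.
    refine (List.toFinset_card_le _).trans ?_
    rw [List.length_map]
    exact hlen
  refine ⟨fun j => entriesMatrix (As.getD j default), fun j => isSymm_entriesMatrix _,
    fun c hc => eq_zero_of_residues R hli c fun i => ?_⟩
  have hj : (i : ℕ) / L < As.length := Nat.div_lt_of_lt_mul i.2
  have hp : ∑ m : exponentSet E, monomialOnCurve ℂ D (As.getD (i / L) default)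
      (ofExponentVector m.1) * C (c m) = 0 := by
    refine Polynomial.funext fun t => ?_
    rw [eval_finsetSum, eval_zero, ← hc ⟨i / L, hj⟩ ![1, t, t ^ D]]
    refine Finset.sum_congr rfl fun m _ => ?_
    rw [eval_mul, eval_C, eval_monomialOnCurve]
  have := congrArg (fun p => coeff p (i % L)) hp
  simp only [finsetSum_coeff, coeff_mul_C, coeff_zero] at this
  rw [← this]
  refine Finset.sum_congr rfl fun m _ => ?_
  rw [← map_monomialOnCurve (Int.castRingHom ℂ), coeff_map]
  rfl

/-- Verify that the monomials in a list are linearly independent on the graphs of the given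
matrices. -/
noncomputable def checkIndependent (d : ℕ) (As : List SymmetricEntries) (E : List Exponent) :
    Bool :=
  -- With `D = d + 1` the monomials of degree `d` in three variables restrict to distinct powers of
  -- `T`, so no rank is lost on the curve. All degrees are at most `d * D`, which accounts for `L =
  -- d * D + 1` slots.
  force (Nat.succ d) fun D => force (Nat.succ (Nat.mul d D)) fun L =>
  force (Nat.mul L As.length) fun N => force (ones L) fun o => force (ones (Nat.succ N)) fun O =>
  force (Nat.pow (nat_lit 2) (Nat.mul (nat_lit 24) L)) fun X =>
  force (Nat.mul (nat_lit 127) o) fun K => force (Nat.mul (nat_lit 131071) o) fun K' =>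
  force (Nat.mul (nat_lit 127) O) fun M => force (Nat.mul (nat_lit 131071) O) fun M' =>
  independentRows K K' D X M M' O N d As E

theorem independentOn_of_checkIndependent {d : ℕ} (hd : d ≤ 12) {As : List SymmetricEntries}
    {E : List Exponent} (hE : ∀ m ∈ E, m.y₁ ≤ d ∧ m.y₂ ≤ d ∧ m.y₃ ≤ d)
    (h : checkIndependent d As E = true) :
    IndependentOn As.length (exponentSet E) := by
  unfold checkIndependent at h
  have key : ∀ L X N, L ≤ 900 → 0 < L → X = 2 ^ (24 * L) → N = L * As.length →
      independentRows (Nat.mul 127 (ones L)) (Nat.mul 131071 (ones L)) (Nat.succ d) X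
        (Nat.mul 127 (ones (N + 1))) (Nat.mul 131071 (ones (N + 1))) (ones (N + 1)) N d As E = true →
      IndependentOn As.length (exponentSet E) := by
    rintro L X N hL hL0 hX rfl h
    exact independentOn_of_independentRows (isMask L) (isMask _) hL hL0 hX hE h
  simp only [force_eq] at h
  refine key _ _ _ ?_ (Nat.succ_pos _) ?_ ?_ h
  · exact (Nat.succ_le_succ (Nat.mul_le_mul hd (Nat.succ_le_succ hd))).trans (by norm_num)
  · generalize Nat.succ (Nat.mul d (Nat.succ d)) = L
    rfl
  · rfl

end InvolutivePlanes

/-! ### Iterated degenerations -/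

namespace InvolutivePlanes

open Matrix

/-- A weight for a one-parameter group, whose weights on `y_i` are `10 ^ 6` minus those on `x_i`,
a threshold and a number of planes. -/
structure Step where
  w₁ : ℕ
  w₂ : ℕ
  w₃ : ℕ
  bound : ℕ
  planes : ℕ

/-- Decide if the weight of a monomial is at most `t`. -/
noncomputable def weightLe (u₁ u₂ u₃ v₁ v₂ v₃ t : ℕ) (m : Exponent) : Bool :=
  Exponent.rec (fun x₁ x₂ x₃ y₁ y₂ y₃ => Nat.ble (Nat.add (Nat.add (Nat.add (Nat.mul x₁ u₁)
    (Nat.mul x₂ u₂)) (Nat.mul x₃ u₃)) (Nat.add (Nat.add (Nat.mul y₁ v₁) (Nat.mul y₂ v₂))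
      (Nat.mul y₃ v₃))) t) m

theorem weightLe_iff {u₁ u₂ u₃ v₁ v₂ v₃ t : ℕ} {m : Exponent} :
    weightLe u₁ u₂ u₃ v₁ v₂ v₃ t m = true ↔
      weight ![u₁, u₂, u₃] ![v₁, v₂, v₃] (exponentVector m) ≤ t := by
  have : weightLe u₁ u₂ u₃ v₁ v₂ v₃ t m = Nat.ble (m.x₁ * u₁ + m.x₂ * u₂ + m.x₃ * u₃ +
    (m.y₁ * v₁ + m.y₂ * v₂ + m.y₃ * v₃)) t := rfl
  rw [this, Nat.ble_eq]
  simp [weight, exponentVector, Fin.sum_univ_three]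

/-- The identity, which keeps the recursion of the kernel shallow. -/
def delay (b : Bool) : Bool := b

/-- Split a list into the members with a property and the other ones. -/
noncomputable def withPartition {α : Type} (p : α → Bool) (l s t : List α)
    (k : List α → List α → Bool) : Bool :=
  List.rec (motive := fun _ => List α → List α → Bool) (fun s t => k s t)
    (fun a _ ih s t => delay (Bool.rec (ih s (List.cons a t)) (ih (List.cons a s) t) (p a))) l s t

theorem withPartition_eq {α : Type} (p : α → Bool) (l s t : List α)
    (k : List α → List α → Bool) :
    withPartition p l s t k = k ((l.filter p).reverse ++ s) ((l.filter (! p ·)).reverse ++ t) := by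
  induction l generalizing s t with
  | nil => rfl
  | cons a l ih =>
    change Bool.rec (motive := fun _ => Bool) (withPartition p l s (List.cons a t) k)
      (withPartition p l (List.cons a s) t k) (p a) = _
    cases h : p a <;> simp [ih, h]

/-- Verify a degeneration, except for the independence of the monomials in the steps outside of
the interval from `lo` to `hi`. -/
noncomputable def checkSteps (d : ℕ) (As : List SymmetricEntries) (lo hi : ℕ) (steps : List Step)
    (j : ℕ) (E : List Exponent) : Bool :=
  List.rec (motive := fun _ => ℕ → List Exponent → Bool)
    (fun _ E => List.rec true (fun _ _ _ => false) E)
    (fun s _ ih j E => Step.rec (fun u₁ u₂ u₃ t k =>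
      force (Nat.sub (nat_lit 1000000) u₁) fun v₁ => force (Nat.sub (nat_lit 1000000) u₂) fun v₂ =>
      force (Nat.sub (nat_lit 1000000) u₃) fun v₃ =>
      andThen (Nat.ble u₁ (nat_lit 1000000)) (andThen (Nat.ble u₂ (nat_lit 1000000))
      (andThen (Nat.ble u₃ (nat_lit 1000000))
      (withPartition (weightLe u₁ u₂ u₃ v₁ v₂ v₃ t) E List.nil List.nil fun B S =>
        andThen (Bool.rec true (Bool.rec true (checkIndependent d (As.take k) B)
          (Nat.ble (Nat.succ j) hi)) (Nat.ble lo j)) (ih (Nat.succ j) S))))) s) steps j E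

/-- The total number of planes in a degeneration. -/
def totalPlanes (As : List SymmetricEntries) (steps : List Step) : ℕ :=
  (steps.map fun s => (As.take s.planes).length).sum

theorem exponentSet_filter (E : List Exponent) (p : Exponent → Bool)
    (q : (Fin 3 ⊕ Fin 3 →₀ ℕ) → Prop) [DecidablePred q]
    (h : ∀ m, p m = true ↔ q (exponentVector m)) :
    exponentSet ((E.filter p).reverse) = (exponentSet E).filter q := by
  ext m
  rw [Finset.mem_filter, mem_exponentSet, mem_exponentSet, List.mem_reverse, List.mem_filter, h,
    exponentVector_ofExponentVector]

/-- Every run repeats the same splittings but tests only the blocks in its own range. As the ranges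
cover all steps, `IndependentOn.add` applies at each of them, and the induction ends with no
monomials on no planes. -/
theorem independentOn_of_checkSteps {d : ℕ} (hd : d ≤ 12) {As : List SymmetricEntries}
    (steps : List Step) (ranges : List (ℕ × ℕ)) (h0 : ranges ≠ []) (j : ℕ) (E : List Exponent)
    (hr : ∀ i, j ≤ i → i < j + steps.length → ∃ r ∈ ranges, r.1 ≤ i ∧ i < r.2)
    (hE : ∀ m ∈ E, m.y₁ ≤ d ∧ m.y₂ ≤ d ∧ m.y₃ ≤ d)
    (h : ∀ r ∈ ranges, checkSteps d As r.1 r.2 steps j E = true) :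
    IndependentOn (totalPlanes As steps) (exponentSet E) := by
  induction steps generalizing j E with
  | nil =>
    obtain ⟨r, hr⟩ := List.exists_mem_of_ne_nil _ h0
    cases E with
    | nil =>
      refine ⟨fun _ => 0, fun _ => Matrix.isSymm_zero, fun c _ => ?_⟩
      ext m
      exact absurd (mem_exponentSet.1 m.2) List.not_mem_nil
    | cons m E => exact absurd (h r hr) Bool.false_ne_true
  | cons s steps ih =>
    have h' : ∀ r ∈ ranges, s.w₁ ≤ 1000000 ∧ s.w₂ ≤ 1000000 ∧ s.w₃ ≤ 1000000 ∧
        (r.1 ≤ j → j < r.2 → checkIndependent d (As.take s.planes) ((E.filter (weightLe s.w₁ s.w₂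
          s.w₃ (1000000 - s.w₁) (1000000 - s.w₂) (1000000 - s.w₃) s.bound)).reverse) = true) ∧
        checkSteps d As r.1 r.2 steps (j + 1) ((E.filter (! weightLe s.w₁ s.w₂ s.w₃
          (1000000 - s.w₁) (1000000 - s.w₂) (1000000 - s.w₃) s.bound ·)).reverse) = true := by
      intro r hr
      have := h r hr
      change force (1000000 - s.w₁) (fun v₁ => force (1000000 - s.w₂) fun v₂ =>
        force (1000000 - s.w₃) fun v₃ => andThen (Nat.ble s.w₁ 1000000)
        (andThen (Nat.ble s.w₂ 1000000) (andThen (Nat.ble s.w₃ 1000000)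
        (withPartition (weightLe s.w₁ s.w₂ s.w₃ v₁ v₂ v₃ s.bound) E List.nil List.nil fun B S =>
          andThen (Bool.rec true (Bool.rec true (checkIndependent d (As.take s.planes) B)
            (Nat.ble (Nat.succ j) r.2)) (Nat.ble r.1 j))
            (checkSteps d As r.1 r.2 steps (Nat.succ j) S))))) = true at this
      simp only [force_eq, andThen_eq_true, withPartition_eq, Nat.ble_eq, List.append_nil] at this
      refine ⟨this.1, this.2.1, this.2.2.1, fun h1 h2 => ?_, this.2.2.2.2⟩
      have h3 := this.2.2.2.1
      rw [Nat.ble_eq_true_of_le h1, Nat.ble_eq_true_of_le h2] at h3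
      exact h3
    obtain ⟨r, hrj, h1, h2⟩ := hr j le_rfl (by rw [List.length_cons]; omega)
    obtain ⟨hw₁, hw₂, hw₃, hB, -⟩ := h' r hrj
    have hab : ∀ i, (![s.w₁, s.w₂, s.w₃] : Fin 3 → ℕ) i +
        ![1000000 - s.w₁, 1000000 - s.w₂, 1000000 - s.w₃] i = 1000000 := by
      intro i
      fin_cases i
      · exact Nat.add_sub_of_le hw₁
      · exact Nat.add_sub_of_le hw₂
      · exact Nat.add_sub_of_le hw₃
    have hsum : totalPlanes As (s :: steps) =
      (As.take s.planes).length + totalPlanes As steps := rfl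
    rw [hsum]
    refine IndependentOn.add hab (τ := s.bound) ?_ ?_
    · rw [← exponentSet_filter E _ _ fun m => weightLe_iff]
      exact independentOn_of_checkIndependent hd
        (fun m hm => hE m (List.mem_filter.1 (List.mem_reverse.1 hm)).1) (hB h1 h2)
    · rw [← exponentSet_filter E (! weightLe s.w₁ s.w₂ s.w₃ (1000000 - s.w₁) (1000000 - s.w₂)
        (1000000 - s.w₃) s.bound ·) _ fun m => by rw [← weightLe_iff]; simp]
      exact ih (j + 1) _ (fun i hi hi' => hr i (by omega) (by rw [List.length_cons]; omega))
        (fun m hm => hE m (List.mem_filter.1 (List.mem_reverse.1 hm)).1)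
        fun r hr => (h' r hr).2.2.2.2

/-- Compose `f 0, …, f n`. -/
noncomputable def composeUpTo {α : Type} (n : ℕ) (f : ℕ → α → α) (a : α) : α :=
  Nat.rec (f Nat.zero a) (fun e b => f (Nat.succ e) b) n

theorem composeUpTo_induction {α : Type} (P : α → Prop) {n : ℕ} {f : ℕ → α → α} {a : α} (ha : P a)
    (hf : ∀ e ≤ n, ∀ b, P b → P (f e b)) : P (composeUpTo n f a) := by
  induction n with
  | zero => exact hf 0 le_rfl a ha
  | succ n ih => exact hf (n + 1) le_rfl _ (ih fun e he => hf e (by omega))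

theorem mem_composeUpTo {β : Type} {n e : ℕ} {f : ℕ → List β → List β} {l : List β} {b : β}
    (hf : ∀ e l, b ∈ l → b ∈ f e l) (he : e ≤ n) (hb : ∀ l, b ∈ f e l) :
    b ∈ composeUpTo n f l := by
  induction n with
  | zero =>
    obtain rfl : e = 0 := by omega
    exact hb l
  | succ n ih =>
    by_cases h : e = n + 1
    · subst h
      exact hb _
    · exact hf _ _ (ih (by omega))

/-- The exponents of the monomials of degree `d`. -/
noncomputable def allExponents (d : ℕ) : List Exponent :=
  composeUpTo d (fun x₁ l => force (Nat.sub d x₁) fun d₁ =>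
    composeUpTo d₁ (fun x₂ l => force (Nat.sub d₁ x₂) fun d₂ =>
      composeUpTo d₂ (fun x₃ l => force (Nat.sub d₂ x₃) fun d₃ =>
        composeUpTo d₃ (fun y₁ l => force (Nat.sub d₃ y₁) fun d₄ =>
          composeUpTo d₄ (fun y₂ l => force (Nat.sub d₄ y₂) fun y₃ =>
            List.cons (Exponent.mk x₁ x₂ x₃ y₁ y₂ y₃) l) l) l) l) l) List.nil

theorem mem_allExponents {d : ℕ} {m : Exponent}
    (h : m.x₁ + m.x₂ + m.x₃ + m.y₁ + m.y₂ + m.y₃ = d) : m ∈ allExponents d := by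
  have hcomp : ∀ (n : ℕ) (f : ℕ → List Exponent → List Exponent),
      (∀ e l, m ∈ l → m ∈ f e l) → ∀ l, m ∈ l → m ∈ composeUpTo n f l := fun n f hf l hl =>
    composeUpTo_induction (fun l => m ∈ l) hl fun e _ l => hf e l
  simp only [allExponents, force_eq]
  refine mem_composeUpTo (e := m.x₁) (fun e l hl => ?_) (by omega) fun l => ?_
  · exact hcomp _ _ (fun _ => hcomp _ _ fun _ => hcomp _ _ fun _ => hcomp _ _ fun _ l hl =>
      List.mem_cons_of_mem _ hl) l hl
  refine mem_composeUpTo (e := m.x₂) (fun e l hl => ?_) (Nat.le_sub_of_add_le (by omega)) fun l => ?_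
  · exact hcomp _ _ (fun _ => hcomp _ _ fun _ => hcomp _ _ fun _ l hl =>
      List.mem_cons_of_mem _ hl) l hl
  refine mem_composeUpTo (e := m.x₃) (fun e l hl => ?_)
    (show m.x₃ ≤ d - m.x₁ - m.x₂ by omega) fun l => ?_
  · exact hcomp _ _ (fun _ => hcomp _ _ fun _ l hl => List.mem_cons_of_mem _ hl) l hl
  refine mem_composeUpTo (e := m.y₁) (fun e l hl => ?_)
    (show m.y₁ ≤ d - m.x₁ - m.x₂ - m.x₃ by omega) fun l => ?_
  · exact hcomp _ _ (fun _ l hl => List.mem_cons_of_mem _ hl) l hl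
  refine mem_composeUpTo (e := m.y₂) (fun e l hl => List.mem_cons_of_mem _ hl)
    (show m.y₂ ≤ d - m.x₁ - m.x₂ - m.x₃ - m.y₁ by omega) fun l => ?_
  have : m = ⟨m.x₁, m.x₂, m.x₃, m.y₁, m.y₂, d - m.x₁ - m.x₂ - m.x₃ - m.y₁ - m.y₂⟩ := by
    rcases m with ⟨a, b, c, e, f, g⟩
    dsimp only at h ⊢
    congr 1
    omega
  rw [this]
  exact List.mem_cons_self

theorem le_of_mem_allExponents {d : ℕ} :
    ∀ m ∈ allExponents d, m.y₁ ≤ d ∧ m.y₂ ≤ d ∧ m.y₃ ≤ d := by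
  simp only [allExponents, force_eq]
  refine composeUpTo_induction (fun l : List Exponent => ∀ m ∈ l, m.y₁ ≤ d ∧ m.y₂ ≤ d ∧ m.y₃ ≤ d) (by simp)
    fun x₁ h₁ l hl => ?_
  refine composeUpTo_induction (fun l : List Exponent => ∀ m ∈ l, m.y₁ ≤ d ∧ m.y₂ ≤ d ∧ m.y₃ ≤ d) hl
    fun x₂ h₂ l hl => ?_
  refine composeUpTo_induction (fun l : List Exponent => ∀ m ∈ l, m.y₁ ≤ d ∧ m.y₂ ≤ d ∧ m.y₃ ≤ d) hl
    fun x₃ h₃ l hl => ?_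
  refine composeUpTo_induction (fun l : List Exponent => ∀ m ∈ l, m.y₁ ≤ d ∧ m.y₂ ≤ d ∧ m.y₃ ≤ d) hl
    fun y₁ h₄ l hl => ?_
  refine composeUpTo_induction (fun l : List Exponent => ∀ m ∈ l, m.y₁ ≤ d ∧ m.y₂ ≤ d ∧ m.y₃ ≤ d) hl
    fun y₂ h₅ l hl => ?_
  intro m hm
  obtain rfl | hm := List.mem_cons.1 hm
  · have h3 : x₃ ≤ d - x₁ - x₂ := h₃
    have h4 : y₁ ≤ d - x₁ - x₂ - x₃ := h₄
    have h5 : y₂ ≤ d - x₁ - x₂ - x₃ - y₁ := h₅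
    refine ⟨by simp only; omega, by simp only; omega, ?_⟩
    change d - x₁ - x₂ - x₃ - y₁ - y₂ ≤ d
    omega
  · exact hl m hm

/-- This makes it enough that the enumerated list contains every monomial of degree `d`. -/
theorem IndependentOn.mono {n k : ℕ} {F F' : Finset (Fin n ⊕ Fin n →₀ ℕ)} (hF : F ⊆ F')
    (h : IndependentOn k F') : IndependentOn k F := by
  classical
  obtain ⟨A, hA, h⟩ := h
  refine ⟨A, hA, fun c hc => ?_⟩
  have := h (fun m => if hm : m.1 ∈ F then c ⟨m.1, hm⟩ else 0) fun j x => by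
    refine (Finset.sum_coe_sort F' fun m => monomialValue m (Sum.elim x (A j *ᵥ x)) *
      (if hm : m ∈ F then c ⟨m, hm⟩ else 0)).trans (Eq.trans ?_ (hc j x))
    rw [← Finset.sum_subset hF, ← Finset.sum_coe_sort F]
    · exact Finset.sum_congr rfl fun m _ => by rw [dif_pos m.2]
    · intro m _ hm
      rw [dif_neg hm, mul_zero]
  ext m
  simpa using congrFun this ⟨m.1, hF m.2⟩

theorem independentOn_exponents {d : ℕ} (hd : d ≤ 12) {As : List SymmetricEntries}
    (steps : List Step) (ranges : List (ℕ × ℕ)) (h0 : ranges ≠ [])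
    (hr : ∀ i < steps.length, ∃ r ∈ ranges, r.1 ≤ i ∧ i < r.2)
    (h : ∀ r ∈ ranges, checkSteps d As r.1 r.2 steps 0 (allExponents d) = true) :
    IndependentOn (totalPlanes As steps) (exponents 3 d) := by
  refine IndependentOn.mono (fun m hm => ?_) (independentOn_of_checkSteps hd steps ranges h0 0 _
    (fun i _ hi => hr i (by omega)) le_of_mem_allExponents h)
  rw [mem_exponentSet]
  apply mem_allExponents
  rw [mem_exponents] at hm
  rw [← hm, Fintype.sum_sum_type, Fin.sum_univ_three, Fin.sum_univ_three]
  simp only [ofExponentVector]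
  ring

end InvolutivePlanes

/-! ### Degenerations for degrees 3 to 12 -/

namespace InvolutivePlanes

/-- Symmetric matrices whose graphs are general enough for all of the degenerations below. -/
def planeList : List SymmetricEntries :=
  [⟨62, 39, 70, 7, 41, 83⟩, ⟨96, 13, 111, 73, 87, 64⟩, ⟨81, 31, 75, 63, 9, 39⟩,
    ⟨120, 79, 37, 30, 77, 72⟩, ⟨72, 98, 70, 103, 62, 72⟩, ⟨6, 41, 109, 22, 33, 51⟩,
    ⟨39, 4, 41, 122, 117, 61⟩, ⟨22, 68, 26, 117, 20, 89⟩, ⟨14, 5, 64, 83, 112, 2⟩]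

/-- A degeneration which separates the monomials of degree `3`. -/
def degeneration3 : List Step :=
  [⟨157790, 77773, 0, 473370, 1⟩, ⟨1000000, 863481, 847094, 458718, 1⟩,
    ⟨471103, 318678, 0, 1471103, 2⟩, ⟨400269, 0, 764773, 2400269, 2⟩]

/-- A degeneration which separates the monomials of degree `4`. -/
def degeneration4 : List Step :=
  [⟨157790, 77773, 0, 631160, 1⟩, ⟨901906, 851389, 1000000, 594444, 1⟩,
    ⟨790652, 1000000, 966938, 1966938, 3⟩, ⟨759846, 1000000, 865251, 2210810, 1⟩,
    ⟨899589, 1000000, 799335, 2899746, 2⟩, ⟨1000000, 966274, 181745, 3784529, 1⟩]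

/-- A degeneration which separates the monomials of degree `5`. -/
def degeneration5 : List Step :=
  [⟨1000000, 835376, 835169, 824155, 1⟩, ⟨79059, 94658, 0, 473290, 1⟩,
    ⟨978923, 1000000, 944866, 1987020, 3⟩, ⟨1000000, 903988, 709407, 2485174, 2⟩,
    ⟨1000000, 928733, 826786, 3000000, 2⟩, ⟨909424, 935053, 1000000, 4090576, 3⟩]

/-- A degeneration which separates the monomials of degree `6`. -/
def degeneration6 : List Step :=
  [⟨863080, 1000000, 886644, 821520, 1⟩, ⟨19755, 0, 136117, 816702, 1⟩,
    ⟨175785, 0, 76453, 1977121, 3⟩, ⟨1000000, 945068, 986428, 1985784, 3⟩,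
    ⟨790256, 764304, 1000000, 2733040, 3⟩, ⟨752417, 851897, 1000000, 3109148, 2⟩,
    ⟨757880, 784087, 1000000, 3294534, 1⟩, ⟨220170, 0, 134209, 3488588, 3⟩]

/-- A degeneration which separates the monomials of degree `7`. -/
def degeneration7 : List Step :=
  [⟨926850, 1000000, 921169, 551817, 1⟩, ⟨0, 40863, 89491, 626437, 1⟩,
    ⟨1000000, 849380, 985824, 1971648, 3⟩, ⟨0, 148916, 1075, 1997850, 3⟩,
    ⟨959909, 817639, 1000000, 2911805, 4⟩, ⟨789968, 830955, 1000000, 3492865, 3⟩,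
    ⟨980475, 894624, 1000000, 4046801, 3⟩, ⟨0, 190741, 222726, 3890904, 4⟩]

/-- A degeneration which separates the monomials of degree `8`. -/
def degeneration8 : List Step :=
  [⟨0, 42318, 16802, 338544, 1⟩, ⟨933652, 909970, 1000000, 720240, 1⟩,
    ⟨9697, 0, 121072, 1937110, 3⟩, ⟨984826, 1000000, 999756, 1986290, 3⟩,
    ⟨122900, 0, 169771, 2924884, 4⟩, ⟨87347, 0, 214124, 3611182, 4⟩,
    ⟨31298, 0, 98738, 3963858, 2⟩, ⟨45080, 0, 234005, 4053685, 1⟩, ⟨57522, 0, 251085, 4230088, 1⟩,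
    ⟨94658, 0, 265062, 4359720, 1⟩, ⟨861152, 890778, 1000000, 4555392, 8⟩]

/-- A degeneration which separates the monomials of degree `9`. -/
def degeneration9 : List Step :=
  [⟨952088, 0, 20144, 431208, 1⟩, ⟨1000000, 899872, 981870, 1990522, 4⟩,
    ⟨1000000, 870802, 937036, 3066234, 5⟩, ⟨1000000, 805949, 954784, 3760733, 4⟩,
    ⟨1000000, 786524, 994180, 4005820, 2⟩, ⟨957544, 729900, 1000000, 4317068, 2⟩,
    ⟨953531, 740509, 1000000, 4639066, 2⟩, ⟨923772, 717663, 1000000, 4900664, 2⟩,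
    ⟨926441, 733874, 1000000, 5036394, 1⟩, ⟨903360, 749679, 1000000, 5306078, 2⟩,
    ⟨875756, 812310, 1000000, 6126892, 5⟩, ⟨465304, 7993, 1000000, 8992007, 7⟩]

/-- A degeneration which separates the monomials of degree `10`. -/
def degeneration10 : List Step :=
  [⟨0, 12031, 5013, 120310, 1⟩, ⟨975088, 1000000, 928644, 713560, 1⟩,
    ⟨1000000, 996459, 917514, 1938760, 3⟩, ⟨4918, 47132, 0, 1982376, 3⟩,
    ⟨0, 89278, 18635, 3003897, 5⟩, ⟨0, 144660, 88951, 3866115, 5⟩,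
    ⟨986369, 1000000, 906208, 2987994, 5⟩, ⟨0, 188522, 200031, 4577075, 5⟩,
    ⟨0, 80444, 169357, 4902618, 3⟩, ⟨0, 82195, 233587, 5082195, 2⟩, ⟨0, 9020, 203273, 5390181, 2⟩,
    ⟨0, 86896, 161212, 5751892, 3⟩, ⟨0, 88185, 166962, 7343332, 8⟩]

/-- A degeneration which separates the monomials of degree `11`. -/
def degeneration11 : List Step :=
  [⟨68003, 0, 2395, 748033, 1⟩, ⟨949539, 1000000, 940508, 654412, 1⟩,
    ⟨101765, 82654, 0, 2896774, 7⟩, ⟨944379, 1000000, 987618, 2919615, 7⟩,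
    ⟨913573, 1000000, 982342, 4017658, 8⟩, ⟨845072, 1000000, 905484, 4716452, 5⟩,
    ⟨831711, 1000000, 935346, 5054920, 3⟩, ⟨813878, 1000000, 911660, 5372244, 3⟩,
    ⟨810617, 1000000, 889290, 5699907, 3⟩, ⟨823643, 1000000, 875075, 6022061, 3⟩,
    ⟨836243, 1000000, 879814, 6257830, 2⟩, ⟨88150, 0, 18195, 4018195, 8⟩,
    ⟨0, 174022, 257153, 6376656, 5⟩]

/-- A degeneration which separates the monomials of degree `12`. -/
def degeneration12 : List Step :=
  [⟨988807, 926293, 1000000, 884484, 1⟩, ⟨7878, 0, 74177, 890124, 1⟩,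
    ⟨8803, 0, 72855, 2834253, 7⟩, ⟨908829, 1000000, 928219, 2839929, 7⟩,
    ⟨71413, 0, 92218, 3970197, 7⟩, ⟨958895, 1000000, 967275, 3984035, 7⟩,
    ⟨117154, 0, 133037, 4782339, 7⟩, ⟨79976, 0, 144873, 5194691, 4⟩,
    ⟨122533, 0, 164787, 5528157, 3⟩, ⟨134433, 0, 193982, 5806598, 3⟩,
    ⟨108131, 0, 143803, 6100395, 3⟩, ⟨143573, 0, 157519, 6282135, 2⟩,
    ⟨145207, 0, 63578, 7000000, 7⟩, ⟨42602, 0, 166522, 8538282, 9⟩]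

set_option maxHeartbeats 0 in
/-- One theorem for all of the checks, so that they are not made in parallel, which would need more
memory. -/
theorem checkSteps_degenerations :
    (∀ r ∈ [(0, 4)], checkSteps 3 planeList r.1 r.2 degeneration3 0 (allExponents 3) = true) ∧
    (∀ r ∈ [(0, 6)], checkSteps 4 planeList r.1 r.2 degeneration4 0 (allExponents 4) = true) ∧
    (∀ r ∈ [(0, 6)], checkSteps 5 planeList r.1 r.2 degeneration5 0 (allExponents 5) = true) ∧
    (∀ r ∈ [(0, 8)], checkSteps 6 planeList r.1 r.2 degeneration6 0 (allExponents 6) = true) ∧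
    (∀ r ∈ [(0, 8)], checkSteps 7 planeList r.1 r.2 degeneration7 0 (allExponents 7) = true) ∧
    (∀ r ∈ [(0, 11)], checkSteps 8 planeList r.1 r.2 degeneration8 0 (allExponents 8) = true) ∧
    (∀ r ∈ [(0, 10), (10, 12)],
      checkSteps 9 planeList r.1 r.2 degeneration9 0 (allExponents 9) = true) ∧
    (∀ r ∈ [(0, 6), (6, 11), (11, 12), (12, 13)],
      checkSteps 10 planeList r.1 r.2 degeneration10 0 (allExponents 10) = true) ∧
    (∀ r ∈ [(0, 3), (3, 4), (4, 5), (5, 8), (8, 11), (11, 12), (12, 13)],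
      checkSteps 11 planeList r.1 r.2 degeneration11 0 (allExponents 11) = true) ∧
    (∀ r ∈ [(0, 3), (3, 4), (4, 5), (5, 6), (6, 7), (7, 10), (10, 12), (12, 13), (13, 14)],
      checkSteps 12 planeList r.1 r.2 degeneration12 0 (allExponents 12) = true) := by
  simp only [List.forall_mem_cons, List.not_mem_nil, IsEmpty.forall_iff, implies_true, and_true]
  repeat' apply And.intro
  all_goals decide +kernel

theorem subspaceCount_eq {m d k : ℕ} (hk : k * formCount (m / 2) d < formCount m d)
    (hk' : formCount m d ≤ (k + 1) * formCount (m / 2) d) : subspaceCount m d = k + 1 := by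
  have h0 : 0 < formCount (m / 2) d := by
    by_contra! h
    rw [Nat.le_zero.1 h] at hk hk'
    omega
  have h : (0 : ℚ) < formCount (m / 2) d := by exact_mod_cast h0
  rw [subspaceCount, Nat.ceil_eq_iff (Nat.succ_ne_zero k), Nat.succ_sub_one, lt_div_iff₀ h,
    div_le_iff₀ h]
  exact ⟨by exact_mod_cast hk, by exact_mod_cast hk'⟩

theorem independentOn_subspaceCount {d : ℕ} (hd₃ : 3 ≤ d) (hd₁₂ : d ≤ 12) :
    IndependentOn (subspaceCount 6 d) (exponents 3 d) := by
  have key : ∀ {steps : List Step} {ranges : List (ℕ × ℕ)} (k : ℕ),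
      (∀ r ∈ ranges, checkSteps d planeList r.1 r.2 steps 0 (allExponents d) = true) →
      ranges ≠ [] → (∀ i < steps.length, ∃ r ∈ ranges, r.1 ≤ i ∧ i < r.2) →
      totalPlanes planeList steps = k + 1 → k * formCount 3 d < formCount 6 d →
      formCount 6 d ≤ (k + 1) * formCount 3 d →
      IndependentOn (subspaceCount 6 d) (exponents 3 d) := by
    intro steps ranges k h h0 hr hsum hk hk'
    rw [subspaceCount_eq hk hk', ← hsum]
    exact independentOn_exponents hd₁₂ steps ranges h0 hr h
  obtain ⟨h3, h4, h5, h6, h7, h8, h9, h10, h11, h12⟩ := checkSteps_degenerations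
  interval_cases d
  -- The first argument is the number of planes minus one; here `56 / 10` is rounded up to `6`.
  · exact key 5 h3 (List.cons_ne_nil _ _) (by decide) rfl (by decide +kernel) (by decide +kernel)
  · exact key 8 h4 (List.cons_ne_nil _ _) (by decide) rfl (by decide +kernel) (by decide +kernel)
  · exact key 11 h5 (List.cons_ne_nil _ _) (by decide) rfl (by decide +kernel) (by decide +kernel)
  · exact key 16 h6 (List.cons_ne_nil _ _) (by decide) rfl (by decide +kernel) (by decide +kernel)
  · exact key 21 h7 (List.cons_ne_nil _ _) (by decide) rfl (by decide +kernel) (by decide +kernel)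
  · exact key 28 h8 (List.cons_ne_nil _ _) (by decide) rfl (by decide +kernel) (by decide +kernel)
  · exact key 36 h9 (List.cons_ne_nil _ _) (by decide) rfl (by decide +kernel) (by decide +kernel)
  · exact key 45 h10 (List.cons_ne_nil _ _) (by decide) rfl (by decide +kernel) (by decide +kernel)
  · exact key 55 h11 (List.cons_ne_nil _ _) (by decide) rfl (by decide +kernel) (by decide +kernel)
  · exact key 67 h12 (List.cons_ne_nil _ _) (by decide) rfl (by decide +kernel) (by decide +kernel)

end InvolutivePlanes

open InvolutivePlanes in
/-- Members of the dense Zariski open set `U` are the tuples of planes in general position. -/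
theorem theorem3 (d : ℕ) (hd₃ : 3 ≤ d) (hd₁₂ : d ≤ 12) :
    ∃ U : Set (InvolutivePlanes.InvolutiveTuple 3 (InvolutivePlanes.subspaceCount 6 d)),
      IsOpen U ∧ Dense U ∧
      ∀ T ∈ U,
        (∀ i j, i ≠ j → Disjoint (T.member i) (T.member j)) ∧
        InvolutivePlanes.HasMaximalRank (InvolutivePlanes.restriction T.union d) :=
  exists_isOpen_dense (by omega) (exists_injective_restriction (by omega)
    (independentOn_subspaceCount hd₃ hd₁₂))
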